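/- Let $B$ be the open unit ball of $\mathbb{R}^3$. For $\eta>0$ consider two functions $F:\mathbb{R}\to(0,\infty)$. (FD) The Fermi--Dirac case: $F(z)=\frac{\mu}{2}\int_0^\infty\frac{\sqrt{t}}{1+e^{t-z}}\,dt$, where $\mu>0$ is given by $\mu^2\eta^3=\frac83$. (sFD) The simplified Fermi--Dirac case: $F=H^{-1}$ is the inverse of the increasing bijection $H:(0,\infty)\to\mathbb{R}$, $H(\rho)=\log\rho+\frac32\,\eta\,\rho^{2/3}$. For $M>0$, a solution of the nonlocal problem $$\Delta\phi=F(\lambda-\phi)\ \text{ in } B,\qquad \phi=0\ \text{ on }\partial B,\qquad \int_B F(\lambda-\phi)\,dx=M \qquad (\ast)$$ is a function $\phi\in C^2(B)\cap C(\overline B)$ that satisfies $(\ast)$ for some $\lambda\in\mathbb{R}$. Let $s\mapsto(x(s),y(s))$, $s\in\mathbb{R}$, be the heteroclinic orbit (unique up to a translation of $s$) of the Maxwell--Boltzmann system $x'=y-x$, $y'=(2-x)\,y$ that tends to $(0,0)$ as $s\to-\infty$ and to $(2,2)$ as $s\to+\infty$. The turning-point masses are the values at the local minima and at the local maxima of $s\mapsto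 4\pi x(s)$. The values at the local minima form a sequence $(M_*^n)_{n\ge1}$ and the values at the local maxima form a sequence $(M^*_n)_{n\ge1}$ such that $M_*^1<M_*^2<\cdots<M^*_2<M^*_1$. For every integer $n\ge1$ and every $M\in(M_*^n,M_*^{n+1})\cup(M^*_{n+1},M^*_n)$ there is $\eta_0>0$ such that, for every $\eta\in(0,\eta_0)$, problem $(\ast)$ has at least $2n$ distinct solutions $\phi$ in the (FD) case and at least $2n$ distinct solutions $\phi$ in the (sFD) case. -/

import Mathlib

open Set Filter Topology MeasureTheory

/-- Three-dimensional Euclidean space. -/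
abbrev E3 : Type := EuclideanSpace ℝ (Fin 3)

/-- The open unit ball `B` of `ℝ³`. -/
abbrev unitBall : Set E3 := Metric.ball (0 : E3) 1

/-! ### The nonlinearities -/

/-- The Fermi function `f_α(z) = ∫_0^∞ x^α / (1 + exp (x - z)) dx` (for `α > -1`). -/
noncomputable def fermi (α z : ℝ) : ℝ :=
  ∫ x in Ioi (0 : ℝ), x ^ α / (1 + Real.exp (x - z))

/-- For `η > 0`, the positive number `μ` such that `μ ^ 2 * η ^ 3 = 8 / 3`. -/
noncomputable def muOf (η : ℝ) : ℝ := Real.sqrt (8 / 3 / η ^ 3)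

/-- Fermi–Dirac case: `F(z) = (μ / 2) f_{1/2}(z)`. -/
noncomputable def fermiDiracF (η z : ℝ) : ℝ := muOf η / 2 * fermi (1 / 2) z

/-- Simplified Fermi–Dirac case: `H(ρ) = log ρ + (3/2) η ρ^{2/3}`, for `ρ > 0`. -/
noncomputable def simplifiedH (η ρ : ℝ) : ℝ :=
  Real.log ρ + 3 / 2 * η * ρ ^ (2 / 3 : ℝ)

/-- Simplified Fermi–Dirac case: `F = H⁻¹`, the inverse of the bijection
`H : (0, ∞) → ℝ`. -/
noncomputable def simplifiedF (η : ℝ) : ℝ → ℝ :=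
  Function.invFunOn (simplifiedH η) (Ioi 0)

theorem muOf_spec {η : ℝ} (hη : 0 < η) : 0 < muOf η ∧ muOf η ^ 2 * η ^ 3 = 8 / 3 := by
  have h3 : 0 < η ^ 3 := by positivity
  refine ⟨Real.sqrt_pos.2 (by positivity), ?_⟩
  rw [muOf, Real.sq_sqrt (by positivity)]
  field_simp

theorem simplifiedH_strictMonoOn {η : ℝ} (hη : 0 < η) :
    StrictMonoOn (simplifiedH η) (Ioi 0) := by
  intro a ha b _ hab
  have ha' : 0 < a := ha
  have h1 := Real.log_lt_log ha' hab
  have h2 := Real.rpow_lt_rpow ha'.le hab (show (0 : ℝ) < 2 / 3 by norm_num)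
  have h3 : 3 / 2 * η * a ^ (2 / 3 : ℝ) < 3 / 2 * η * b ^ (2 / 3 : ℝ) :=
    mul_lt_mul_of_pos_left h2 (by positivity)
  simp only [simplifiedH]
  linarith

theorem simplifiedH_surjOn {η : ℝ} (hη : 0 < η) :
    SurjOn (simplifiedH η) (Ioi 0) univ := by
  have hc : ContinuousOn (fun t : ℝ => simplifiedH η (Real.exp t)) univ := by
    apply Continuous.continuousOn
    have he : (fun t : ℝ => simplifiedH η (Real.exp t))
        = fun t => t + 3 / 2 * η * Real.exp (t * (2 / 3)) := by
      funext t
      simp only [simplifiedH, Real.log_exp, ← Real.exp_mul]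
    rw [he]
    fun_prop
  intro z _
  have hb : simplifiedH η (Real.exp (z - 3 / 2 * η * Real.exp (z * (2 / 3)))) ≤ z := by
    simp only [simplifiedH, Real.log_exp, ← Real.exp_mul]
    have hle : Real.exp ((z - 3 / 2 * η * Real.exp (z * (2 / 3))) * (2 / 3))
        ≤ Real.exp (z * (2 / 3)) := by
      apply Real.exp_le_exp.2
      have : 0 < 3 / 2 * η * Real.exp (z * (2 / 3)) := by positivity
      linarith
    have := mul_le_mul_of_nonneg_left hle (show 0 ≤ 3 / 2 * η by positivity)
    linarith
  have ht : z ≤ simplifiedH η (Real.exp z) := by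
    simp only [simplifiedH, Real.log_exp]
    have : 0 ≤ 3 / 2 * η * Real.exp z ^ (2 / 3 : ℝ) := by positivity
    linarith
  obtain ⟨t, -, h⟩ := isPreconnected_univ.intermediate_value (mem_univ _) (mem_univ _) hc ⟨hb, ht⟩
  exact ⟨Real.exp t, Real.exp_pos t, h⟩

/-- `simplifiedF η z` is the positive solution `ρ` of `H(ρ) = z`. -/
theorem simplifiedF_spec {η : ℝ} (hη : 0 < η) (z : ℝ) :
    0 < simplifiedF η z ∧ simplifiedH η (simplifiedF η z) = z := by
  have h := simplifiedH_surjOn hη (mem_univ z)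
  exact ⟨Function.invFunOn_mem h, Function.invFunOn_eq h⟩

/-! ### The nonlocal boundary value problem -/

/-- `φ` (of which only the values on the closed unit ball matter) is a classical solution of
`Δφ = F(λ - φ)` in `B`, `φ = 0` on `∂B`, `∫_B F(λ - φ) dx = M`, for some real multiplier `λ`. -/
structure IsSolution (F : ℝ → ℝ) (M : ℝ) (φ : E3 → ℝ) : Prop where
  contDiffOn : ContDiffOn ℝ 2 φ unitBall
  continuousOn : ContinuousOn φ (Metric.closedBall (0 : E3) 1)
  boundary : ∀ x ∈ Metric.sphere (0 : E3) 1, φ x = 0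
  equation : ∃ lam : ℝ,
    (∀ x ∈ unitBall, Laplacian.laplacian φ x = F (lam - φ x)) ∧
      ∫ x in unitBall, F (lam - φ x) = M

/-- There are at least `N` solutions, which are pairwise different as functions on `B`. -/
def HasAtLeastSolutions (F : ℝ → ℝ) (M : ℝ) (N : ℕ) : Prop :=
  ∃ Φ : Fin N → E3 → ℝ, (∀ i, IsSolution F M (Φ i)) ∧
    Pairwise fun i j => ¬ EqOn (Φ i) (Φ j) unitBall

/-! ### The Maxwell–Boltzmann spiral and its turning points -/

/-- `(x, y)` is a parametrization of the heteroclinic orbit of `x' = y - x`, `y' = (2 - x) y`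
that joins `(0, 0)` to `(2, 2)`. -/
structure IsHeteroclinic (x y : ℝ → ℝ) : Prop where
  deriv_x : ∀ s, HasDerivAt x (y s - x s) s
  deriv_y : ∀ s, HasDerivAt y ((2 - x s) * y s) s
  tendsto_atBot : Tendsto (fun s => (x s, y s)) atBot (𝓝 (0, 0))
  tendsto_atTop : Tendsto (fun s => (x s, y s)) atTop (𝓝 (2, 2))

/-- The lower turning masses: the local minimum values of the mass `4 π x` along the
heteroclinic orbit. -/
def lowerTurningMasses : Set ℝ :=
  {m | ∃ x y : ℝ → ℝ, IsHeteroclinic x y ∧ ∃ s, IsLocalMin x s ∧ m = 4 * Real.pi * x s}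

/-- The upper turning masses: the local maximum values of the mass `4 π x` along the
heteroclinic orbit. -/
def upperTurningMasses : Set ℝ :=
  {m | ∃ x y : ℝ → ℝ, IsHeteroclinic x y ∧ ∃ s, IsLocalMax x s ∧ m = 4 * Real.pi * x s}

/-- `Mlo 1 < Mlo 2 < ⋯` is the increasing enumeration of all the lower turning masses,
`Mup 1 > Mup 2 > ⋯` is the decreasing enumeration of all the upper turning masses, and every
lower turning mass is smaller than every upper one. The two sequences are determined by this. -/
structure AreTurningMasses (Mlo Mup : ℕ+ → ℝ) : Prop where
  strictMono_lo : StrictMono Mlo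
  range_lo : range Mlo = lowerTurningMasses
  strictAnti_up : StrictAnti Mup
  range_up : range Mup = upperTurningMasses
  lo_lt_up : ∀ m n, Mlo m < Mup n

/-! All the solutions constructed are radial. With `v = λ - φ`, up to an additive constant, the
equation becomes `Δv = -G(v)`, where `G` is a translate of `F`. For every central value `a` there is
exactly one radial solution, and its mass in the unit ball, `4π · radialMass G a`, depends
continuously on `a`. Each `a` at which this mass equals `M` gives a solution of the nonlocal
problem, because the free multiplier `λ` absorbs both the boundary value of `v` and the translation.
Different `a` give different `φ`, since `Δφ(0) = G(a)` and `G` is strictly increasing.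

For `G = exp`, the Emden change of variables turns the radial solution into the heteroclinic orbit,
and scaling invariance gives `radialMass exp (2s) = x(s)`: the limiting mass diagram is the spiral
itself (`exists_isHeteroclinic_radialMass`). The energy `(x-2)²/2 + y - 2 - 2 log(y/2)` decreases
strictly along the orbit, and at a critical point of `x`, where `y = x`, it is a function of `x`
monotone on each side of `2`. Hence the successive maxima decrease and the successive minima
increase. A Riccati equation for the slope seen from `(2,2)` shows that there are infinitely many of
them (`not_eventually_same_sign`).

If `M` lies strictly between the `n`-th minimum and the `n`-th maximum, it separates a point near
`-∞`, where the mass is small, and the first `n` maxima and `n` minima, which alternate. These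
`2n+1` points produce `2n` sign changes of mass minus `M`.

As `η → 0`, suitable translates of both nonlinearities converge to `exp` uniformly on half-lines
`(-∞, A]`. A radial solution never exceeds its central value, so a Gronwall-type estimate carries
this convergence over to the masses at the `2n+1` points (`abs_radialMass_sub_le`). The strict signs
persist for small `η`, and the intermediate value theorem gives `2n` roots. -/

/-! ### Radial solutions in the variable `q = |x|²`: integral form and stability. -/

/-- The weighted mean `∫_0^1 t² g(q t²) dt`. -/
noncomputable def radialMean (g : ℝ → ℝ) (q : ℝ) : ℝ := ∫ t in (0 : ℝ)..1, t ^ 2 * g (q * t ^ 2)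

/-- `v` is a solution, in the variable `q = |x|²`, of the radial form of `Δ v = -G(v)` that takes
the value `a` at the origin. -/
structure IsRadial (G : ℝ → ℝ) (a : ℝ) (v : ℝ → ℝ) : Prop where
  continuousOn : ContinuousOn v (Ici 0)
  zero : v 0 = a
  hasDerivAt : ∀ q, 0 < q → HasDerivAt v (-(1 / 2) * radialMean (fun s => G (v s)) q) q

theorem continuous_radialMean {g : ℝ → ℝ} (hg : Continuous g) : Continuous (radialMean g) := by
  unfold radialMean
  apply intervalIntegral.continuous_parametric_intervalIntegral_of_continuous'
  fun_prop

theorem radialMean_congr {g h : ℝ → ℝ} {q : ℝ} (hq : 0 ≤ q) (hgh : ∀ s ∈ Icc 0 q, g s = h s) :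
    radialMean g q = radialMean h q := by
  unfold radialMean
  apply intervalIntegral.integral_congr
  intro t ht
  rw [uIcc_of_le zero_le_one] at ht
  have : t ^ 2 ≤ 1 := by nlinarith [ht.1, ht.2]
  simp only
  rw [hgh _ ⟨by positivity, by nlinarith⟩]

theorem continuousOn_radialMean {g : ℝ → ℝ} (hg : ContinuousOn g (Ici 0)) :
    ContinuousOn (radialMean g) (Ici 0) := by
  have h : Continuous fun s => g (max s 0) :=
    hg.comp_continuous (by fun_prop) fun s => le_max_right s 0
  refine (continuous_radialMean h).continuousOn.congr fun q hq => ?_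
  exact radialMean_congr hq fun s hs => by rw [max_eq_left hs.1]

theorem intervalIntegrable_radialMean {g : ℝ → ℝ} (hg : ContinuousOn g (Ici 0)) {q : ℝ}
    (hq : 0 ≤ q) :
    IntervalIntegrable (fun t => t ^ 2 * g (q * t ^ 2)) volume 0 1 := by
  apply ContinuousOn.intervalIntegrable
  apply ContinuousOn.mul (by fun_prop)
  apply hg.comp (by fun_prop)
  intro t _
  exact mul_nonneg hq (sq_nonneg t)

theorem abs_radialMean_sub_le {g h : ℝ → ℝ} {q C : ℝ} (hq : 0 ≤ q)
    (hg : ContinuousOn g (Ici 0)) (hh : ContinuousOn h (Ici 0))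
    (hC : ∀ s ∈ Icc 0 q, |g s - h s| ≤ C) : |radialMean g q - radialMean h q| ≤ C := by
  unfold radialMean
  rw [← intervalIntegral.integral_sub (intervalIntegrable_radialMean hg hq)
    (intervalIntegrable_radialMean hh hq), ← Real.norm_eq_abs]
  refine (intervalIntegral.norm_integral_le_of_norm_le_const (C := C) fun t ht => ?_).trans
    (by simp)
  rw [uIoc_of_le zero_le_one] at ht
  have ht1 : t ^ 2 ≤ 1 := by nlinarith [ht.1, ht.2]
  have := hC (q * t ^ 2) ⟨by positivity, by nlinarith⟩
  rw [← mul_sub, norm_mul, Real.norm_eq_abs, Real.norm_eq_abs, abs_of_nonneg (sq_nonneg t)]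
  calc t ^ 2 * _ ≤ 1 * _ := mul_le_mul_of_nonneg_right ht1 (abs_nonneg _)
    _ ≤ C := by rwa [one_mul]

theorem radialMean_pos {g : ℝ → ℝ} {q : ℝ} (hq : 0 ≤ q)
    (hg : ContinuousOn g (Ici 0)) (hpos : ∀ s, 0 < g s) : 0 < radialMean g q := by
  apply intervalIntegral.intervalIntegral_pos_of_pos_on (intervalIntegrable_radialMean hg hq) _
    zero_lt_one
  intro t ht
  have := ht.1
  have := hpos (q * t ^ 2)
  positivity

namespace IsRadial

variable {G : ℝ → ℝ} {a : ℝ} {v : ℝ → ℝ}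

theorem continuousOn_comp (h : IsRadial G a v) (hG : Continuous G) :
    ContinuousOn (fun s => G (v s)) (Ici 0) := hG.comp_continuousOn h.continuousOn

theorem eq_integral (h : IsRadial G a v) (hG : Continuous G) {q : ℝ} (hq : 0 ≤ q) :
    v q = a - (1 / 2) * ∫ s in (0 : ℝ)..q, radialMean (fun s => G (v s)) s := by
  have hc := continuousOn_radialMean (h.continuousOn_comp hG)
  have := intervalIntegral.integral_eq_sub_of_hasDerivAt_of_le hq
    (h.continuousOn.mono Icc_subset_Ici_self)
    (fun s hs => h.hasDerivAt s hs.1)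
    (((continuousOn_const.mul hc).mono Icc_subset_Ici_self).intervalIntegrable_of_Icc hq)
  rw [intervalIntegral.integral_const_mul, h.zero] at this
  linarith

theorem le (h : IsRadial G a v) (hG : Continuous G) (hpos : ∀ z, 0 < G z) {q : ℝ} (hq : 0 ≤ q) :
    v q ≤ a := by
  rw [h.eq_integral hG hq]
  have : 0 ≤ ∫ s in (0 : ℝ)..q, radialMean (fun s => G (v s)) s :=
    intervalIntegral.integral_nonneg hq fun s hs =>
      (radialMean_pos hs.1 (h.continuousOn_comp hG) fun _ => hpos _).le
  linarith

end IsRadial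

theorem integral_exp_mul_le {K q : ℝ} (hK : 0 < K) :
    ∫ s in (0 : ℝ)..q, Real.exp (K * s) ≤ Real.exp (K * q) / K := by
  have : ∫ s in (0 : ℝ)..q, Real.exp (K * s) = (Real.exp (K * q) - 1) / K := by
    rw [intervalIntegral.integral_comp_mul_left (fun s => Real.exp s) hK.ne', integral_exp]
    simp [div_eq_inv_mul]
  rw [this]
  gcongr
  linarith

/-- Two radial solutions with nearby data stay close. -/
theorem IsRadial.abs_sub_le {G₁ G₂ : ℝ → ℝ} {a₁ a₂ A L ε R : ℝ} {v₁ v₂ : ℝ → ℝ}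
    (h₁ : IsRadial G₁ a₁ v₁) (h₂ : IsRadial G₂ a₂ v₂)
    (hG₁ : Continuous G₁) (hG₂ : Continuous G₂)
    (hv₁ : ∀ q, 0 ≤ q → v₁ q ≤ A) (hv₂ : ∀ q, 0 ≤ q → v₂ q ≤ A) (hL : 0 < L) (hε : 0 ≤ ε)
    (hlip : ∀ z ≤ A, ∀ w ≤ A, |G₁ z - G₁ w| ≤ L * |z - w|)
    (hclose : ∀ z ≤ A, |G₁ z - G₂ z| ≤ ε) {q : ℝ} (hq : q ∈ Icc 0 R) :
    |v₁ q - v₂ q| ≤ 2 * (|a₁ - a₂| + ε * R) * Real.exp (L * R) := by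
  have hR : 0 ≤ R := hq.1.trans hq.2
  have hc : ContinuousOn (fun q => Real.exp (-(L * q)) * |v₁ q - v₂ q|) (Icc 0 R) := by
    have h1 : ContinuousOn v₁ (Icc 0 R) := h₁.continuousOn.mono Icc_subset_Ici_self
    have h2 : ContinuousOn v₂ (Icc 0 R) := h₂.continuousOn.mono Icc_subset_Ici_self
    fun_prop
  -- Gronwall through a weighted maximum: at the point `p` where `e^{-Lq}|v₁ - v₂|` is largest, the
  -- integral equation bounds this maximum `D` by the data plus `D/2`. The factor `1/2` comes from
  -- the equation, since `∫ L e^{Ls}` over `[0, p]` is at most `e^{Lp}`.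
  obtain ⟨p, hp, hmax⟩ := isCompact_Icc.exists_isMaxOn ⟨q, hq⟩ hc
  set D := Real.exp (-(L * p)) * |v₁ p - v₂ p| with hD
  have hDle : ∀ s ∈ Icc 0 R, |v₁ s - v₂ s| ≤ D * Real.exp (L * s) := by
    intro s hs
    have h0 : Real.exp (-(L * s)) * |v₁ s - v₂ s| ≤ D := hmax hs
    have : |v₁ s - v₂ s| = Real.exp (-(L * s)) * |v₁ s - v₂ s| * Real.exp (L * s) := by
      rw [mul_right_comm, ← Real.exp_add]; simp
    rw [this]
    gcongr
  have hD0 : 0 ≤ D := by positivity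
  have hmean : ∀ s ∈ Icc 0 R, |radialMean (fun s => G₁ (v₁ s)) s
      - radialMean (fun s => G₂ (v₂ s)) s| ≤ L * D * Real.exp (L * s) + ε := by
    intro s hs
    apply abs_radialMean_sub_le hs.1 (h₁.continuousOn_comp hG₁) (h₂.continuousOn_comp hG₂)
    intro t ht
    have ht' : t ∈ Icc 0 R := ⟨ht.1, ht.2.trans hs.2⟩
    calc |G₁ (v₁ t) - G₂ (v₂ t)| ≤ |G₁ (v₁ t) - G₁ (v₂ t)| + |G₁ (v₂ t) - G₂ (v₂ t)| :=
          _root_.abs_sub_le _ _ _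
      _ ≤ L * |v₁ t - v₂ t| + ε :=
          add_le_add (hlip _ (hv₁ t ht.1) _ (hv₂ t ht.1)) (hclose _ (hv₂ t ht.1))
      _ ≤ L * (D * Real.exp (L * s)) + ε := by
          have : Real.exp (L * t) ≤ Real.exp (L * s) :=
            Real.exp_le_exp.2 (mul_le_mul_of_nonneg_left ht.2 hL.le)
          have := (hDle t ht').trans (mul_le_mul_of_nonneg_left this hD0)
          gcongr
      _ = _ := by ring
  have hkey : |v₁ p - v₂ p| ≤ |a₁ - a₂| + (1 / 2) * (D * Real.exp (L * p) + ε * R) := by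
    have hi : ∀ {G v : ℝ → ℝ} {a : ℝ}, IsRadial G a v → Continuous G →
        IntervalIntegrable (radialMean fun s => G (v s)) volume 0 p := fun h hG =>
      ((continuousOn_radialMean (h.continuousOn_comp hG)).mono
        Icc_subset_Ici_self).intervalIntegrable_of_Icc hp.1
    rw [h₁.eq_integral hG₁ hp.1, h₂.eq_integral hG₂ hp.1]
    have e : ∀ x y : ℝ, a₁ - 1 / 2 * x - (a₂ - 1 / 2 * y) = (a₁ - a₂) - 1 / 2 * (x - y) := by
      intros; ring
    rw [e, ← intervalIntegral.integral_sub (hi h₁ hG₁) (hi h₂ hG₂)]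
    refine (abs_sub _ _).trans ?_
    rw [abs_mul, abs_of_pos (show (0 : ℝ) < 1 / 2 by norm_num), ← Real.norm_eq_abs (∫ _ in _..p, _)]
    gcongr
    refine (intervalIntegral.norm_integral_le_of_norm_le hp.1
      (Eventually.of_forall fun s hs => hmean s ⟨hs.1.le, hs.2.trans hp.2⟩)
      (Continuous.intervalIntegrable (by fun_prop) _ _)).trans ?_
    rw [intervalIntegral.integral_add (Continuous.intervalIntegrable (by fun_prop) _ _)
      (Continuous.intervalIntegrable (by fun_prop) _ _), intervalIntegral.integral_const_mul,
      intervalIntegral.integral_const, sub_zero, smul_eq_mul, mul_comm p]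
    have h1 := integral_exp_mul_le (q := p) hL
    have h2 : L * D * ∫ s in (0 : ℝ)..p, Real.exp (L * s) ≤ D * Real.exp (L * p) := by
      calc _ ≤ L * D * (Real.exp (L * p) / L) := by gcongr
        _ = _ := by field_simp
    have := mul_le_mul_of_nonneg_left hp.2 hε
    linarith
  have hDfin : D ≤ 2 * (|a₁ - a₂| + ε * R) := by
    have hp1 : Real.exp (-(L * p)) ≤ 1 := Real.exp_le_one_iff.2 (by nlinarith [hp.1])
    have hpe : Real.exp (-(L * p)) * Real.exp (L * p) = 1 := by rw [← Real.exp_add]; simp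
    have h1 : D ≤ Real.exp (-(L * p)) * (|a₁ - a₂| + (1 / 2) * (D * Real.exp (L * p) + ε * R)) := by
      rw [hD] at hkey ⊢
      gcongr
    have h2 : Real.exp (-(L * p)) * (|a₁ - a₂| + (1 / 2) * (D * Real.exp (L * p) + ε * R))
        = Real.exp (-(L * p)) * (|a₁ - a₂| + (1 / 2) * (ε * R)) + 1 / 2 * D := by
      linear_combination (1 / 2) * D * hpe
    have h3 : Real.exp (-(L * p)) * (|a₁ - a₂| + (1 / 2) * (ε * R))
        ≤ 1 * (|a₁ - a₂| + (1 / 2) * (ε * R)) := by gcongr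
    have : 0 ≤ ε * R := by positivity
    have := abs_nonneg (a₁ - a₂)
    linarith
  calc |v₁ q - v₂ q| ≤ D * Real.exp (L * q) := hDle q hq
    _ ≤ _ := by
      gcongr
      exact hq.2

/-! ### Global existence by contraction in an exponentially weighted space. -/

theorem abs_radialMean_le_exp {g : ℝ → ℝ} {C K : ℝ} (hC : 0 ≤ C) (hK : 0 ≤ K)
    (hg : ∀ s, |g s| ≤ C * Real.exp (K * |s|)) (q : ℝ) :
    |radialMean g q| ≤ C * Real.exp (K * |q|) := by
  unfold radialMean
  rw [← Real.norm_eq_abs (∫ _ in _.._, _)]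
  refine (intervalIntegral.norm_integral_le_of_norm_le_const (C := C * Real.exp (K * |q|))
    fun t ht => ?_).trans (by simp)
  rw [uIoc_of_le zero_le_one] at ht
  have ht1 : t ^ 2 ≤ 1 := by nlinarith [ht.1, ht.2]
  rw [norm_mul, Real.norm_eq_abs, Real.norm_eq_abs, abs_of_nonneg (sq_nonneg t)]
  calc t ^ 2 * _ ≤ 1 * _ := mul_le_mul_of_nonneg_right ht1 (abs_nonneg _)
    _ ≤ C * Real.exp (K * |q * t ^ 2|) := by rw [one_mul]; exact hg _
    _ ≤ _ := by
      rw [abs_mul, abs_of_nonneg (sq_nonneg t)]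
      gcongr
      exact mul_le_of_le_one_right (abs_nonneg q) ht1

theorem abs_integral_le_exp {g : ℝ → ℝ} {C K : ℝ} (hC : 0 ≤ C) (hK : 0 < K)
    (hg : ∀ s, |g s| ≤ C * Real.exp (K * |s|)) (q : ℝ) :
    |∫ s in (0 : ℝ)..q, g s| ≤ C / K * Real.exp (K * |q|) := by
  have main : ∀ h : ℝ → ℝ, (∀ s, |h s| ≤ C * Real.exp (K * |s|)) → ∀ q, 0 ≤ q →
      |∫ s in (0 : ℝ)..q, h s| ≤ C / K * Real.exp (K * q) := by
    intro h hh q hq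
    rw [← Real.norm_eq_abs]
    refine (intervalIntegral.norm_integral_le_of_norm_le hq
      (g := fun s => C * Real.exp (K * s)) (Eventually.of_forall fun s hs => ?_)
      (Continuous.intervalIntegrable (by fun_prop) _ _)).trans ?_
    · simpa [abs_of_pos hs.1] using hh s
    · rw [intervalIntegral.integral_const_mul]
      calc C * _ ≤ C * (Real.exp (K * q) / K) := by gcongr; exact integral_exp_mul_le hK
        _ = _ := by ring
  rcases le_total 0 q with hq | hq
  · rw [abs_of_nonneg hq]
    exact main g hg q hq
  · have := main (fun s => g (-s)) (fun s => by simpa using hg (-s)) (-q) (by linarith)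
    rw [intervalIntegral.integral_comp_neg, neg_neg, neg_zero, intervalIntegral.integral_symm,
      abs_neg] at this
    rwa [abs_of_nonpos hq]

theorem radialMean_sub {g h : ℝ → ℝ} (hg : Continuous g) (hh : Continuous h) (q : ℝ) :
    radialMean g q - radialMean h q = radialMean (fun s => g s - h s) q := by
  unfold radialMean
  rw [← intervalIntegral.integral_sub (Continuous.intervalIntegrable (by fun_prop) _ _)
    (Continuous.intervalIntegrable (by fun_prop) _ _)]
  simp only [mul_sub]

/-- Global solvability of the radial integral equation with a Lipschitz nonlinearity. -/
theorem exists_radial_integral_eq {G : ℝ → ℝ} {L : ℝ} (hL : 0 < L)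
    (hlip : ∀ z w, |G z - G w| ≤ L * |z - w|) (a : ℝ) :
    ∃ v : ℝ → ℝ, Continuous v ∧
      ∀ q, v q = a - (1 / 2) * ∫ s in (0 : ℝ)..q, radialMean (fun s => G (v s)) s := by
  have hG : Continuous G := by
    have : LipschitzWith L.toNNReal G := LipschitzWith.of_dist_le_mul fun z w => by
      simpa [Real.dist_eq, hL.le] using hlip z w
    exact this.continuous
  -- The unknown is `v = a + e^{L|q|} f` with `f` bounded. In the sup norm of `f` the integral
  -- operator has Lipschitz constant `1/2` whatever `L` is. Negative `q` are included so that `v` is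
  -- differentiable on both sides of `0`.
  let lift : BoundedContinuousFunction ℝ ℝ → ℝ → ℝ := fun f q => a + Real.exp (L * |q|) * f q
  have hlift : ∀ f, Continuous (lift f) := fun f => by
    have := f.continuous
    fun_prop
  let T : BoundedContinuousFunction ℝ ℝ → ℝ → ℝ := fun f q =>
    Real.exp (-(L * |q|)) * (-(1 / 2) * ∫ s in (0 : ℝ)..q, radialMean (fun s => G (lift f s)) s)
  have hmc : ∀ f, Continuous (radialMean fun s => G (lift f s)) := fun f =>
    continuous_radialMean (hG.comp (hlift f))
  have hTc : ∀ f, Continuous (T f) := fun f => by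
    have := intervalIntegral.continuous_primitive (μ := volume) (fun x y => (hmc f).intervalIntegrable x y) 0
    fun_prop
  have hexp : ∀ q : ℝ, Real.exp (-(L * |q|)) * Real.exp (L * |q|) = 1 := fun q => by
    rw [← Real.exp_add]; simp
  have hbound : ∀ {g : ℝ → ℝ} {C : ℝ}, 0 ≤ C → (∀ s, |g s| ≤ C * Real.exp (L * |s|)) → ∀ q,
      |Real.exp (-(L * |q|)) * (-(1 / 2) * ∫ s in (0 : ℝ)..q, radialMean g s)| ≤
        1 / 2 * (C / L) := by
    intro g C hC hg q
    have h1 := abs_integral_le_exp hC hL (abs_radialMean_le_exp hC hL.le hg) q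
    rw [abs_mul, abs_mul, abs_of_pos (Real.exp_pos _), abs_neg,
      abs_of_pos (show (0 : ℝ) < 1 / 2 by norm_num)]
    calc _ ≤ Real.exp (-(L * |q|)) * (1 / 2 * (C / L * Real.exp (L * |q|))) := by gcongr
      _ = 1 / 2 * (C / L) * (Real.exp (-(L * |q|)) * Real.exp (L * |q|)) := by ring
      _ = _ := by rw [hexp, mul_one]
  have hTb : ∀ f q, ‖T f q‖ ≤ 1 / 2 * ((|G a| + L * ‖f‖) / L) := by
    intro f q
    refine hbound (by positivity) (fun s => ?_) q
    have h1 := hlip (lift f s) a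
    have h2 : |lift f s - a| ≤ Real.exp (L * |s|) * ‖f‖ := by
      simp only [lift, add_sub_cancel_left, abs_mul, Real.abs_exp]
      gcongr
      exact f.norm_coe_le_norm s
    have h3 : |G (lift f s)| ≤ |G (lift f s) - G a| + |G a| := by
      simpa using abs_add_le (G (lift f s) - G a) (G a)
    have h4 : (1 : ℝ) ≤ Real.exp (L * |s|) := Real.one_le_exp (by positivity)
    have h5 := mul_le_mul_of_nonneg_left h2 hL.le
    have h6 := mul_le_mul_of_nonneg_left h4 (abs_nonneg (G a))
    linarith
  let Φ : BoundedContinuousFunction ℝ ℝ → BoundedContinuousFunction ℝ ℝ := fun f =>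
    BoundedContinuousFunction.ofNormedAddCommGroup (T f) (hTc f) _ (hTb f)
  have hΦ : ContractingWith (1 / 2) Φ := by
    refine ⟨by norm_num, LipschitzWith.of_dist_le_mul fun f g => ?_⟩
    rw [BoundedContinuousFunction.dist_le (by positivity)]
    intro q
    have hd : T f q - T g q = Real.exp (-(L * |q|)) * (-(1 / 2) * ∫ s in (0 : ℝ)..q,
        radialMean (fun s => G (lift f s) - G (lift g s)) s) := by
      simp only [T]
      rw [← mul_sub, ← mul_sub, ← intervalIntegral.integral_sub ((hmc f).intervalIntegrable _ _)
        ((hmc g).intervalIntegrable _ _)]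
      congr 3
      funext s
      exact radialMean_sub (hG.comp (hlift f)) (hG.comp (hlift g)) s
    change dist (T f q) (T g q) ≤ _
    rw [Real.dist_eq, hd]
    refine (hbound (C := L * dist f g) (by positivity) (fun s => ?_) q).trans ?_
    · refine (hlip _ _).trans ?_
      have : lift f s - lift g s = Real.exp (L * |s|) * (f s - g s) := by simp only [lift]; ring
      rw [this, abs_mul, Real.abs_exp, mul_assoc, mul_comm (dist f g)]
      gcongr
      rw [← Real.dist_eq]
      exact BoundedContinuousFunction.dist_coe_le_dist s
    · rw [mul_div_cancel_left₀ _ hL.ne']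
      simp
  obtain ⟨f, hf⟩ : ∃ f, Φ f = f := ⟨_, hΦ.fixedPoint_isFixedPt⟩
  refine ⟨lift f, hlift f, fun q => ?_⟩
  have h1 : T f q = f q := DFunLike.congr_fun hf q
  have h2 : lift f q = a + Real.exp (L * |q|) * T f q := by rw [h1]
  rw [h2]
  simp only [T]
  linear_combination (-(1 / 2) * ∫ s in (0 : ℝ)..q, radialMean (fun s => G (lift f s)) s) * hexp q

/-! ### Regularity, existence and uniqueness for admissible nonlinearities. -/

/-- Nonlinearities that are `C¹`, positive, increasing and satisfy `G' ≤ G`. -/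
structure Admissible (G : ℝ → ℝ) : Prop where
  contDiff : ContDiff ℝ 1 G
  pos : ∀ z, 0 < G z
  deriv_pos : ∀ z, 0 < deriv G z
  deriv_le : ∀ z, deriv G z ≤ G z

theorem hasDerivAt_radialMean {g : ℝ → ℝ} (hg : ContDiff ℝ 1 g) (q : ℝ) :
    HasDerivAt (radialMean g) (∫ t in (0 : ℝ)..1, t ^ 4 * deriv g (q * t ^ 2)) q := by
  have hg0 : Continuous g := hg.continuous
  have hg' : Continuous (deriv g) := hg.continuous_deriv le_rfl
  obtain ⟨C, hC⟩ := (isCompact_closedBall (0 : ℝ) (|q| + 1)).exists_bound_of_continuousOn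
    hg'.continuousOn
  refine (intervalIntegral.hasDerivAt_integral_of_dominated_loc_of_deriv_le
    (F := fun q t => t ^ 2 * g (q * t ^ 2)) (F' := fun q t => t ^ 4 * deriv g (q * t ^ 2))
    (bound := fun _ => C) (Metric.ball_mem_nhds q one_pos)
    (Eventually.of_forall fun p => Continuous.aestronglyMeasurable (by fun_prop))
    (Continuous.intervalIntegrable (by fun_prop) _ _)
    (Continuous.aestronglyMeasurable (by fun_prop))
    (Eventually.of_forall fun t ht p hp => ?_) (by simp)
    (Eventually.of_forall fun t _ p _ => ?_)).2
  · rw [uIoc_of_le zero_le_one] at ht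
    have ht2 : t ^ 2 ≤ 1 := by nlinarith [ht.1, ht.2]
    have ht4 : t ^ 4 ≤ 1 := by nlinarith [sq_nonneg t]
    rw [Metric.mem_ball, Real.dist_eq] at hp
    have hp1 : |p| ≤ |q| + 1 := by
      have := abs_sub_abs_le_abs_sub p q
      linarith
    have : ‖deriv g (p * t ^ 2)‖ ≤ C := by
      apply hC
      rw [mem_closedBall_zero_iff, norm_mul, Real.norm_eq_abs, Real.norm_eq_abs,
        abs_of_nonneg (sq_nonneg t)]
      exact (mul_le_of_le_one_right (abs_nonneg p) ht2).trans hp1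
    rw [norm_mul, Real.norm_eq_abs (t ^ 4), abs_of_nonneg (by positivity)]
    exact (mul_le_of_le_one_left (norm_nonneg _) ht4).trans this
  · have h1 : HasDerivAt (fun p : ℝ => p * t ^ 2) (t ^ 2) p := by
      simpa using (hasDerivAt_id p).mul_const (t ^ 2)
    have h2 := (((hg.differentiable one_ne_zero).differentiableAt.hasDerivAt
      (x := p * t ^ 2)).comp p h1).const_mul (t ^ 2)
    exact h2.congr_deriv (by ring)

theorem contDiff_radialMean {g : ℝ → ℝ} (hg : ContDiff ℝ 1 g) : ContDiff ℝ 1 (radialMean g) := by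
  rw [contDiff_one_iff_deriv]
  refine ⟨fun q => (hasDerivAt_radialMean hg q).differentiableAt, ?_⟩
  have hg' : Continuous (deriv g) := hg.continuous_deriv le_rfl
  have : deriv (radialMean g) = fun q => ∫ t in (0 : ℝ)..1, t ^ 4 * deriv g (q * t ^ 2) :=
    funext fun q => (hasDerivAt_radialMean hg q).deriv
  rw [this]
  apply intervalIntegral.continuous_parametric_intervalIntegral_of_continuous'
  fun_prop

/-- The left side is the integral over `[0, 1]` of the `t`-derivative of `t³ g(q t²)`. It recovers
the second-order equation from the integral one without dividing by `q`, so it also holds at the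
origin. -/
theorem deriv_radialMean_eq {g : ℝ → ℝ} (hg : ContDiff ℝ 1 g) (q : ℝ) :
    2 * q * deriv (radialMean g) q + 3 * radialMean g q = g q := by
  have hg0 : Continuous g := hg.continuous
  have hg' : Continuous (deriv g) := hg.continuous_deriv le_rfl
  rw [(hasDerivAt_radialMean hg q).deriv, radialMean, ← intervalIntegral.integral_const_mul,
    ← intervalIntegral.integral_const_mul, ← intervalIntegral.integral_add
      (Continuous.intervalIntegrable (by fun_prop) _ _)
      (Continuous.intervalIntegrable (by fun_prop) _ _)]
  have := intervalIntegral.integral_eq_sub_of_hasDerivAt (a := (0 : ℝ)) (b := 1)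
    (f := fun t : ℝ => t ^ 3 * g (q * t ^ 2))
    (f' := fun t => 2 * q * (t ^ 4 * deriv g (q * t ^ 2)) + 3 * (t ^ 2 * g (q * t ^ 2)))
    (fun t _ => ?_) (Continuous.intervalIntegrable (by fun_prop) _ _)
  · rw [this]; simp
  · have h1 : HasDerivAt (fun t : ℝ => q * t ^ 2) (q * (2 * t)) t := by
      simpa using (hasDerivAt_pow 2 t).const_mul q
    have h2 := (hasDerivAt_pow 3 t).mul
      (((hg.differentiable one_ne_zero).differentiableAt.hasDerivAt (x := q * t ^ 2)).comp t h1)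
    refine h2.congr_deriv ?_
    simp only [Function.comp_apply]
    push_cast
    ring

/-- A radial solution that is `C²` up to the origin. -/
structure IsRegularRadial (G : ℝ → ℝ) (a : ℝ) (v : ℝ → ℝ) : Prop where
  contDiff : ContDiff ℝ 2 v
  zero : v 0 = a
  deriv_eq : ∀ q, 0 ≤ q → deriv v q = -(1 / 2) * radialMean (fun s => G (v s)) q
  ode : ∀ q, 0 ≤ q → 4 * q * deriv (deriv v) q + 6 * deriv v q = -G (v q)

theorem IsRegularRadial.isRadial {G : ℝ → ℝ} {a : ℝ} {v : ℝ → ℝ} (h : IsRegularRadial G a v) :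
    IsRadial G a v where
  continuousOn := h.contDiff.continuous.continuousOn
  zero := h.zero
  hasDerivAt q hq := by
    rw [← h.deriv_eq q hq.le]
    exact (h.contDiff.differentiable two_ne_zero).differentiableAt.hasDerivAt

/-- Bootstrap: the integral equation makes a continuous solution `C¹`, hence `G ∘ v` and its radial
mean are `C¹`, hence `v` is `C²`. -/
theorem exists_isRegularRadial_of_lipschitz {G : ℝ → ℝ} {L : ℝ} (hL : 0 < L)
    (hG : ContDiff ℝ 1 G) (hlip : ∀ z w, |G z - G w| ≤ L * |z - w|) (a : ℝ) :
    ∃ v, IsRegularRadial G a v := by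
  obtain ⟨v, hv, heq⟩ := exists_radial_integral_eq hL hlip a
  have hd : ∀ q, HasDerivAt v (-(1 / 2) * radialMean (fun s => G (v s)) q) q := by
    intro q
    have hc : Continuous (radialMean fun s => G (v s)) := continuous_radialMean (hG.continuous.comp hv)
    have h := ((intervalIntegral.integral_hasDerivAt_right (hc.intervalIntegrable 0 q)
      (hc.stronglyMeasurableAtFilter _ _) hc.continuousAt).const_mul (1 / 2)).const_sub a
    rw [← neg_mul] at h
    exact h.congr_of_eventuallyEq (Eventually.of_forall heq)
  have hdv : deriv v = fun q => -(1 / 2) * radialMean (fun s => G (v s)) q :=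
    funext fun q => (hd q).deriv
  have hv1 : ContDiff ℝ 1 v := by
    rw [contDiff_one_iff_deriv, hdv]
    exact ⟨fun q => (hd q).differentiableAt,
      continuous_const.mul (continuous_radialMean (hG.continuous.comp hv))⟩
  have hP := contDiff_radialMean (hG.comp hv1)
  have hv2 : ContDiff ℝ 2 v := by
    have h2 : (2 : WithTop ℕ∞) = 1 + 1 := by norm_num
    rw [h2, contDiff_succ_iff_deriv, hdv]
    exact ⟨fun q => (hd q).differentiableAt, by simp, contDiff_const.mul hP⟩
  refine ⟨v, hv2, by simpa using heq 0, fun q _ => (hd q).deriv, fun q _ => ?_⟩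
  have h1 : deriv (deriv v) q = -(1 / 2) * deriv (radialMean (G ∘ v)) q := by
    rw [hdv]
    exact deriv_const_mul _ (hP.differentiable one_ne_zero).differentiableAt
  have h2 := deriv_radialMean_eq (hG.comp hv1) q
  rw [h1, (hd q).deriv]
  simp only [Function.comp_def] at h2 ⊢
  linarith

namespace Admissible

variable {G : ℝ → ℝ}

theorem continuous (h : Admissible G) : Continuous G := h.contDiff.continuous

theorem hasDerivAt (h : Admissible G) (z : ℝ) : HasDerivAt G (deriv G z) z :=
  (h.contDiff.differentiable one_ne_zero).differentiableAt.hasDerivAt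

theorem strictMono (h : Admissible G) : StrictMono G := strictMono_of_deriv_pos h.deriv_pos

/-- Since `G' ≤ G` and `G` increases, `G A` serves as a Lipschitz constant on the half-line below
`A`. -/
theorem abs_sub_le (h : Admissible G) {A : ℝ} {z w : ℝ} (hz : z ≤ A) (hw : w ≤ A) :
    |G z - G w| ≤ G A * |z - w| := by
  have := Convex.norm_image_sub_le_of_norm_deriv_le (f := G) (s := Iic A) (C := G A)
    (fun x _ => (h.contDiff.differentiable one_ne_zero).differentiableAt)
    (fun x hx => by
      rw [Real.norm_eq_abs, abs_of_pos (h.deriv_pos x)]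
      exact (h.deriv_le x).trans (h.strictMono.monotone hx)) (convex_Iic A) hw hz
  simpa using this

theorem exists_isRegularRadial (h : Admissible G) (a : ℝ) : ∃ v, IsRegularRadial G a v := by
  have hG' : Continuous (deriv G) := h.contDiff.continuous_deriv le_rfl
  have hc : Continuous fun t => deriv G (min t a) := by fun_prop
  -- Above `a`, the nonlinearity is replaced by its tangent line at `a`. The result is globally
  -- Lipschitz, and its solution never exceeds `a` for `q ≥ 0`, so it does not see the change.
  let K : ℝ → ℝ := fun z => G a + ∫ t in a..z, deriv G (min t a)
  have hK : ∀ z, HasDerivAt K (deriv G (min z a)) z := fun z =>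
    (intervalIntegral.integral_hasDerivAt_right (hc.intervalIntegrable a z)
      (hc.stronglyMeasurableAtFilter _ _) hc.continuousAt).const_add _
  have hK' : deriv K = fun z => deriv G (min z a) := funext fun z => (hK z).deriv
  have hKdiff : Differentiable ℝ K := fun z => (hK z).differentiableAt
  have hKG : ∀ z ≤ a, K z = G z := by
    intro z hz
    have : ∫ t in a..z, deriv G (min t a) = ∫ t in a..z, deriv G t := by
      apply intervalIntegral.integral_congr
      intro t ht
      rw [uIcc_of_ge hz] at ht
      simp only [min_eq_left ht.2]
    simp only [K]
    rw [this, intervalIntegral.integral_deriv_eq_sub' G rfl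
      (fun x _ => (h.contDiff.differentiable one_ne_zero).differentiableAt) hG'.continuousOn]
    ring
  have hKmono : StrictMono K := strictMono_of_deriv_pos fun z => by
    rw [hK']; exact h.deriv_pos _
  have hKpos : ∀ z, 0 < K z := by
    intro z
    rcases le_total z a with hz | hz
    · rw [hKG z hz]; exact h.pos z
    · exact (by rw [hKG a le_rfl]; exact h.pos a : 0 < K a).trans_le (hKmono.monotone hz)
  have hlip : ∀ z w, |K z - K w| ≤ G a * |z - w| := by
    intro z w
    have := Convex.norm_image_sub_le_of_norm_deriv_le (f := K) (s := univ) (C := G a)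
      (fun x _ => hKdiff x)
      (fun x _ => by
        rw [hK', Real.norm_eq_abs, abs_of_pos (h.deriv_pos _)]
        exact (h.deriv_le _).trans (h.strictMono.monotone (min_le_right _ _)))
      convex_univ (mem_univ w) (mem_univ z)
    simpa using this
  obtain ⟨v, hv⟩ := exists_isRegularRadial_of_lipschitz (h.pos a)
    (contDiff_one_iff_deriv.2 ⟨hKdiff, by rw [hK']; exact hc⟩) hlip a
  have hle : ∀ q, 0 ≤ q → v q ≤ a := fun q hq => hv.isRadial.le hKdiff.continuous hKpos hq
  refine ⟨v, hv.contDiff, hv.zero, fun q hq => ?_, fun q hq => ?_⟩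
  · rw [hv.deriv_eq q hq]
    congr 1
    exact radialMean_congr hq fun s hs => hKG _ (hle s hs.1)
  · rw [hv.ode q hq, hKG _ (hle q hq)]

theorem isRadial_le (h : Admissible G) {a : ℝ} {v : ℝ → ℝ} (hv : IsRadial G a v) {q : ℝ}
    (hq : 0 ≤ q) : v q ≤ a := hv.le h.continuous h.pos hq

/-- Radial solutions are unique. -/
theorem isRadial_unique (h : Admissible G) {a : ℝ} {v₁ v₂ : ℝ → ℝ} (h₁ : IsRadial G a v₁)
    (h₂ : IsRadial G a v₂) {q : ℝ} (hq : 0 ≤ q) : v₁ q = v₂ q := by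
  have := h₁.abs_sub_le h₂ h.continuous h.continuous (fun _ => h.isRadial_le h₁)
    (fun _ => h.isRadial_le h₂) (h.pos a) le_rfl (fun z hz w hw => h.abs_sub_le hz hw)
    (fun z _ => by simp) (q := q) (R := q) ⟨hq, le_rfl⟩
  simp only [sub_self, abs_zero, zero_mul, add_zero, mul_zero] at this
  exact sub_eq_zero.1 (abs_nonpos_iff.1 this)

end Admissible

/-! ### The mass as a function of the central value. -/

/-- The radial solution with value `a` at the origin. -/
noncomputable def radialSolution (G : ℝ → ℝ) (a : ℝ) : ℝ → ℝ :=
  Classical.epsilon fun v => IsRegularRadial G a v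

theorem Admissible.radialSolution_spec {G : ℝ → ℝ} (h : Admissible G) (a : ℝ) :
    IsRegularRadial G a (radialSolution G a) :=
  Classical.epsilon_spec (h.exists_isRegularRadial a)

theorem Admissible.continuous_comp {G v : ℝ → ℝ} {a : ℝ} (h : Admissible G)
    (hv : IsRegularRadial G a v) : Continuous fun s => G (v s) :=
  h.continuous.comp hv.contDiff.continuous

/-- The mass in the unit ball of the radial solution with value `a` at the origin, divided
by `4π`. -/
noncomputable def radialMass (G : ℝ → ℝ) (a : ℝ) : ℝ :=
  radialMean (fun s => G (radialSolution G a s)) 1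

/-- One estimate serves twice: with `G₁ = G₂` it gives continuity in the central value, and with `a₁
= a₂` it gives stability under perturbation of the nonlinearity. Closeness is needed only below `A`,
because both solutions stay there. -/
theorem abs_radialMass_sub_le {G₁ G₂ : ℝ → ℝ} (h₁ : Admissible G₁) (h₂ : Admissible G₂)
    {A a₁ a₂ ε : ℝ} (ha₁ : a₁ ≤ A) (ha₂ : a₂ ≤ A) (hε : 0 ≤ ε)
    (hclose : ∀ z ≤ A, |G₁ z - G₂ z| ≤ ε) :
    |radialMass G₁ a₁ - radialMass G₂ a₂| ≤
      G₁ A * (2 * (|a₁ - a₂| + ε) * Real.exp (G₁ A)) + ε := by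
  have hv₁ := h₁.radialSolution_spec a₁
  have hv₂ := h₂.radialSolution_spec a₂
  have hle₁ : ∀ q, 0 ≤ q → radialSolution G₁ a₁ q ≤ A := fun q hq =>
    (h₁.isRadial_le hv₁.isRadial hq).trans ha₁
  have hle₂ : ∀ q, 0 ≤ q → radialSolution G₂ a₂ q ≤ A := fun q hq =>
    (h₂.isRadial_le hv₂.isRadial hq).trans ha₂
  apply abs_radialMean_sub_le zero_le_one (h₁.continuous_comp hv₁).continuousOn
    (h₂.continuous_comp hv₂).continuousOn
  intro s hs
  have := hv₁.isRadial.abs_sub_le hv₂.isRadial h₁.continuous h₂.continuous hle₁ hle₂ (h₁.pos A) hε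
    (fun z hz w hw => h₁.abs_sub_le hz hw) hclose hs
  rw [mul_one, mul_one] at this
  calc _ ≤ |G₁ (radialSolution G₁ a₁ s) - G₁ (radialSolution G₂ a₂ s)|
        + |G₁ (radialSolution G₂ a₂ s) - G₂ (radialSolution G₂ a₂ s)| := _root_.abs_sub_le _ _ _
    _ ≤ G₁ A * |radialSolution G₁ a₁ s - radialSolution G₂ a₂ s| + ε :=
      add_le_add (h₁.abs_sub_le (hle₁ s hs.1) (hle₂ s hs.1)) (hclose _ (hle₂ s hs.1))
    _ ≤ _ := by
      have := (h₁.pos A).le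
      gcongr

theorem Admissible.continuous_radialMass {G : ℝ → ℝ} (h : Admissible G) :
    Continuous (radialMass G) := by
  rw [continuous_iff_continuousAt]
  intro a
  rw [ContinuousAt, tendsto_iff_norm_sub_tendsto_zero]
  have hlim : Tendsto (fun b => G (a + 1) * (2 * (|b - a| + 0) * Real.exp (G (a + 1))) + 0) (𝓝 a)
      (𝓝 0) := by
    have : Continuous fun b => G (a + 1) * (2 * (|b - a| + 0) * Real.exp (G (a + 1))) + 0 := by
      fun_prop
    simpa using this.tendsto a
  refine squeeze_zero' (Eventually.of_forall fun _ => norm_nonneg _) ?_ hlim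
  filter_upwards [Iic_mem_nhds (show a < a + 1 by linarith)] with b hb
  exact abs_radialMass_sub_le h h hb (by linarith) le_rfl fun z _ => by simp

/-! ### From radial profiles to solutions on the ball. -/

theorem laplacian_comp_norm_sq {v : ℝ → ℝ} (hv : ContDiff ℝ 2 v) (x : E3) :
    Laplacian.laplacian (fun x : E3 => v (‖x‖ ^ 2)) x =
      4 * ‖x‖ ^ 2 * deriv (deriv v) (‖x‖ ^ 2) + 6 * deriv v (‖x‖ ^ 2) := by
  have hv' : ContDiff ℝ 1 (deriv v) := by
    have h2 : (2 : WithTop ℕ∞) = 1 + 1 := by norm_num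
    rw [h2, contDiff_succ_iff_deriv] at hv
    exact hv.2.2
  have hsq : ∀ y : E3, HasFDerivAt (fun x : E3 => ‖x‖ ^ 2) (2 • innerSL ℝ y) y := fun y =>
    (hasStrictFDerivAt_norm_sq y).hasFDerivAt
  have h1 : ∀ y : E3, HasFDerivAt (fun x : E3 => v (‖x‖ ^ 2))
      (deriv v (‖y‖ ^ 2) • (2 • innerSL ℝ y)) y := fun y =>
    ((hv.differentiable two_ne_zero).differentiableAt.hasDerivAt).comp_hasFDerivAt y (hsq y)
  have hf : fderiv ℝ (fun x : E3 => v (‖x‖ ^ 2)) = fun y =>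
      deriv v (‖y‖ ^ 2) • ((2 : ℝ) • innerSL ℝ y) := by
    funext y
    rw [(h1 y).fderiv]
    simp [two_smul]
  let I : E3 →L[ℝ] E3 →L[ℝ] ℝ := innerSL ℝ
  have hI : HasFDerivAt (fun y : E3 => innerSL ℝ y) I x := I.hasFDerivAt
  have hIapp : ∀ y z : E3, I y z = inner ℝ y z := fun _ _ => rfl
  have h2 : HasFDerivAt (fun y : E3 => deriv v (‖y‖ ^ 2) • ((2 : ℝ) • innerSL ℝ y))
      (deriv v (‖x‖ ^ 2) • ((2 : ℝ) • I) +
        (deriv (deriv v) (‖x‖ ^ 2) • (2 • innerSL ℝ x)).smulRight ((2 : ℝ) • innerSL ℝ x)) x :=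
    (((hv'.differentiable one_ne_zero).differentiableAt.hasDerivAt).comp_hasFDerivAt x
      (hsq x)).smul (hI.const_smul (2 : ℝ))
  rw [InnerProductSpace.laplacian_eq_iteratedFDeriv_orthonormalBasis _
    (EuclideanSpace.basisFun (Fin 3) ℝ)]
  simp only [iteratedFDeriv_two_apply, hf, h2.fderiv]
  simp [hIapp, EuclideanSpace.inner_single_right, EuclideanSpace.norm_sq_eq, Fin.sum_univ_three]
  ring

theorem integral_unitBall_radial (g : ℝ → ℝ) :
    ∫ x in unitBall, g (‖x‖ ^ 2) = 4 * Real.pi * radialMean g 1 := by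
  have h1 : ∫ x in unitBall, g (‖x‖ ^ 2) = ∫ x : E3, (Iio (1 : ℝ)).indicator (fun r => g (r ^ 2)) ‖x‖ := by
    rw [← integral_indicator measurableSet_ball]
    congr 1
    funext x
    by_cases hx : ‖x‖ < 1
    · rw [indicator_of_mem (by simpa using hx), indicator_of_mem (by simpa using hx)]
    · rw [indicator_of_notMem (by simpa using hx), indicator_of_notMem (by simpa using hx)]
  rw [h1, integral_fun_norm_addHaar]
  have h2 : ∫ y in Ioi (0 : ℝ), y ^ (Module.finrank ℝ E3 - 1) •
      (Iio (1 : ℝ)).indicator (fun r => g (r ^ 2)) y = radialMean g 1 := by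
    rw [radialMean, intervalIntegral.integral_of_le zero_le_one, integral_Ioc_eq_integral_Ioo,
      ← Ioi_inter_Iio, ← setIntegral_indicator measurableSet_Iio]
    apply integral_congr_ae
    refine Eventually.of_forall fun t => ?_
    by_cases ht : t < 1
    · simp [ht]
    · simp [ht]
  rw [h2]
  have h3 : (volume : Measure E3).real (Metric.ball 0 1) = 4 / 3 * Real.pi := by
    rw [Measure.real, EuclideanSpace.volume_ball_fin_three]
    rw [ENNReal.toReal_mul, ENNReal.toReal_ofReal (by positivity)]
    simp
    ring
  rw [h3]
  simp
  ring

/-- Subtracting the boundary value gives `φ = v(1) - v(|x|²)`; with the multiplier `λ = v(1) - c`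
one gets `λ - φ = v - c`. The shift `c` is thus invisible in the nonlocal problem. -/
theorem IsRegularRadial.isSolution {F : ℝ → ℝ} {a c : ℝ} {v : ℝ → ℝ}
    (h : IsRegularRadial (fun z => F (z - c)) a v) :
    IsSolution F (4 * Real.pi * radialMean (fun s => F (v s - c)) 1)
      (fun x => v 1 - v (‖x‖ ^ 2)) where
  contDiffOn := by
    have := h.contDiff
    exact (contDiff_const.sub (this.comp (contDiff_norm_sq ℝ))).contDiffOn
  continuousOn := by
    have := h.contDiff.continuous
    fun_prop
  boundary x hx := by
    rw [mem_sphere_zero_iff_norm] at hx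
    simp [hx]
  equation := by
    refine ⟨v 1 - c, fun x _ => ?_, ?_⟩
    · have h1 := laplacian_comp_norm_sq (v := fun q => v 1 - v q) (contDiff_const.sub h.contDiff) x
      have h2 : deriv (fun q => v 1 - v q) = fun q => -deriv v q := by
        funext q
        exact deriv_const_sub _
      rw [h1, h2, deriv.fun_neg]
      have h3 := h.ode (‖x‖ ^ 2) (by positivity)
      have h4 : v 1 - c - (v 1 - v (‖x‖ ^ 2)) = v (‖x‖ ^ 2) - c := by ring
      rw [h4]
      linarith
    · rw [← integral_unitBall_radial]
      congr 1
      funext x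
      congr 1
      ring

/-- Sign changes of the mass along the family of radial solutions produce solutions of the
nonlocal problem. -/
theorem hasAtLeastSolutions_of_sign_changes {F : ℝ → ℝ} {c M : ℝ}
    (hF : Admissible fun z => F (z - c)) {N : ℕ} {a : ℕ → ℝ} (ha : ∀ i < N, a i < a (i + 1))
    (hsign : ∀ i < N, (4 * Real.pi * radialMass (fun z => F (z - c)) (a i) - M) *
      (4 * Real.pi * radialMass (fun z => F (z - c)) (a (i + 1)) - M) < 0) :
    HasAtLeastSolutions F M N := by
  set G : ℝ → ℝ := fun z => F (z - c) with hG
  have hroot : ∀ i : Fin N, ∃ b ∈ Ioo (a i) (a (i + 1)), 4 * Real.pi * radialMass G b = M := by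
    intro i
    have hc : ContinuousOn (fun b => 4 * Real.pi * radialMass G b) (Icc (a i) (a (i + 1))) :=
      (continuous_const.mul hF.continuous_radialMass).continuousOn
    have hlt := ha i i.2
    rcases mul_neg_iff.1 (hsign i i.2) with ⟨h1, h2⟩ | ⟨h1, h2⟩
    · obtain ⟨b, hb, hbM⟩ := intermediate_value_Ioo' hlt.le hc (show M ∈ Ioo _ _ from
        ⟨by linarith, by linarith⟩)
      exact ⟨b, hb, hbM⟩
    · obtain ⟨b, hb, hbM⟩ := intermediate_value_Ioo hlt.le hc (show M ∈ Ioo _ _ from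
        ⟨by linarith, by linarith⟩)
      exact ⟨b, hb, hbM⟩
  choose b hb hbM using hroot
  have hmono : ∀ i j : ℕ, i ≤ j → j ≤ N → a i ≤ a j := by
    intro i j hij
    induction j, hij using Nat.le_induction with
    | base => exact fun _ => le_rfl
    | succ k _ ih => exact fun hk => (ih (by omega)).trans (ha k (by omega)).le
  -- The roots lie in disjoint consecutive open intervals.
  have hbmono : StrictMono b := fun i j hij =>
    ((hb i).2.trans_le (hmono (i + 1) j hij (by omega))).trans (hb j).1
  have hrad := fun i => hF.radialSolution_spec (b i)
  refine ⟨fun i x => radialSolution G (b i) 1 - radialSolution G (b i) (‖x‖ ^ 2),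
    fun i => ?_, fun i j hij heq => ?_⟩
  · have := (hrad i).isSolution
    rwa [← hbM i]
  -- The Laplacian at the origin determines the central value, so two profiles that agree on the
  -- ball have the same `b`.
  · have h0 : ∀ i, Laplacian.laplacian
        (fun x : E3 => radialSolution G (b i) 1 - radialSolution G (b i) (‖x‖ ^ 2)) 0 = G (b i) := by
      intro i
      have h1 := laplacian_comp_norm_sq
        (v := fun q => radialSolution G (b i) 1 - radialSolution G (b i) q)
        (contDiff_const.sub (hrad i).contDiff) 0
      have h2 := (hrad i).ode 0 le_rfl
      rw [(hrad i).zero] at h2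
      rw [h1]
      have h3 : deriv (fun q => radialSolution G (b i) 1 - radialSolution G (b i) q)
          = fun q => -deriv (radialSolution G (b i)) q := funext fun q => deriv_const_sub _
      rw [h3]
      simp only [norm_zero, ne_eq, OfNat.ofNat_ne_zero, not_false_eq_true, zero_pow, mul_zero,
        zero_mul, zero_add] at h2 ⊢
      linarith
    have hev : (fun x : E3 => radialSolution G (b i) 1 - radialSolution G (b i) (‖x‖ ^ 2)) =ᶠ[𝓝 0]
        fun x : E3 => radialSolution G (b j) 1 - radialSolution G (b j) (‖x‖ ^ 2) :=
      heq.eventuallyEq_of_mem (Metric.ball_mem_nhds 0 one_pos)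
    have h1 := (InnerProductSpace.laplacian_congr_nhds hev).eq_of_nhds
    rw [h0, h0] at h1
    exact hij (hbmono.injective (hF.strictMono.injective h1))

/-! ### Convergence to the equilibrium `(2, 2)` -/

/-- With `u = √(y/2)` this is `log u ≤ u - 1`. It shows that the energy controls the distance of `y`
from `2`. -/
theorem sq_sqrt_half_sub_one_le {y : ℝ} (hy : 0 < y) :
    2 * (Real.sqrt (y / 2) - 1) ^ 2 ≤ y - 2 - 2 * Real.log (y / 2) := by
  have h1 : Real.log (y / 2) = 2 * Real.log (Real.sqrt (y / 2)) := by
    rw [Real.log_sqrt (by positivity)]; ring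
  have h2 := Real.log_le_sub_one_of_pos (Real.sqrt_pos.2 (show 0 < y / 2 by positivity))
  have h3 := Real.sq_sqrt (show 0 ≤ y / 2 by positivity)
  rw [h1]
  nlinarith

/-- From `log w ≥ 1 - 1/w`. Where `y` is bounded below it gives a quadratic upper bound on the
energy. -/
theorem entropy_le {y : ℝ} (hy : 0 < y) :
    y - 2 - 2 * Real.log (y / 2) ≤ (y - 2) ^ 2 / y := by
  have h1 := Real.one_sub_inv_le_log_of_pos (show 0 < y / 2 by positivity)
  have h2 : (y - 2) ^ 2 / y = y - 2 - 2 * (1 - (y / 2)⁻¹) := by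
    field_simp
  rw [h2]
  linarith

theorem tendsto_zero_of_sq {f : ℝ → ℝ} {l : Filter ℝ}
    (h : Tendsto (fun s => f s ^ 2) l (𝓝 0)) : Tendsto f l (𝓝 0) := by
  have h2 := (Real.continuous_sqrt.tendsto 0).comp h
  rw [Real.sqrt_zero] at h2
  refine (tendsto_zero_iff_abs_tendsto_zero _).2 (h2.congr fun s => ?_)
  simp [Real.sqrt_sq_eq_abs]

/-- The energy of the Maxwell–Boltzmann system. -/
noncomputable def energy (x y : ℝ) : ℝ := (x - 2) ^ 2 / 2 + (y - 2 - 2 * Real.log (y / 2))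

theorem hasDerivAt_energy {x y : ℝ → ℝ} {s : ℝ} (hx : HasDerivAt x (y s - x s) s)
    (hy : HasDerivAt y ((2 - x s) * y s) s) (hpos : 0 < y s) :
    HasDerivAt (fun s => energy (x s) (y s)) (-(x s - 2) ^ 2) s := by
  have h1 := (((hx.sub_const 2).pow 2).div_const 2).add
    ((hy.sub_const 2).sub (((hy.div_const 2).log (by positivity)).const_mul 2))
  refine h1.congr_deriv ?_
  field_simp
  ring

theorem energy_nonneg {x y : ℝ} (hy : 0 < y) : 0 ≤ energy x y := by
  have := sq_sqrt_half_sub_one_le hy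
  unfold energy
  have h2 := sq_nonneg (x - 2)
  have h3 := sq_nonneg (Real.sqrt (y / 2) - 1)
  linarith

/-- The energy dissipates only through `(x-2)²`. Adding a small multiple of the cross term
`(2-x)(y-2)` makes the dissipation control `(y-2)²` as well, which forces the energy to `0`. -/
theorem tendsto_equilibrium {x y : ℝ → ℝ} (hx : ∀ s, HasDerivAt x (y s - x s) s)
    (hy : ∀ s, HasDerivAt y ((2 - x s) * y s) s) (hpos : ∀ s, 0 < y s) :
    Tendsto (fun s => (x s, y s)) atTop (𝓝 (2, 2)) := by
  set E : ℝ → ℝ := fun s => energy (x s) (y s) with hE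
  have hEd : ∀ s, HasDerivAt E (-(x s - 2) ^ 2) s := fun s =>
    hasDerivAt_energy (hx s) (hy s) (hpos s)
  have hanti : Antitone E := antitone_of_deriv_nonpos (fun s => (hEd s).differentiableAt)
    fun s => by rw [(hEd s).deriv]; nlinarith [sq_nonneg (x s - 2)]
  have hE0 : ∀ s, 0 ≤ E s := fun s => energy_nonneg (hpos s)
  have hxE : ∀ s, (x s - 2) ^ 2 ≤ 2 * E s := by
    intro s
    have h1 := sq_sqrt_half_sub_one_le (hpos s)
    have h2 := sq_nonneg (Real.sqrt (y s / 2) - 1)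
    simp only [hE, energy]
    linarith
  have hyE : ∀ s, 2 * (Real.sqrt (y s / 2) - 1) ^ 2 ≤ E s := by
    intro s
    have h1 := sq_sqrt_half_sub_one_le (hpos s)
    have h2 := sq_nonneg (x s - 2)
    simp only [hE, energy]
    linarith
  obtain ⟨Y, hY0, hY⟩ : ∃ Y, 0 < Y ∧ ∀ s, 0 ≤ s → y s ≤ Y := by
    refine ⟨2 * (E 0 + 3), by linarith [hE0 0], fun s hs => ?_⟩
    have h1 := hyE s
    have h2 := hanti hs
    have h3 := Real.sq_sqrt (show 0 ≤ y s / 2 by linarith [hpos s])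
    nlinarith [sq_nonneg (Real.sqrt (y s / 2) - 2), hE0 0]
  obtain ⟨m, hm0, hm⟩ : ∃ m, 0 < m ∧ ∀ s, 0 ≤ s → m ≤ y s := by
    refine ⟨2 * Real.exp (-(E 0 + 2) / 2), by positivity, fun s hs => ?_⟩
    have h2 := hanti hs
    have h4 : -(E 0 + 2) / 2 ≤ Real.log (y s / 2) := by
      have h5 : y s - 2 - 2 * Real.log (y s / 2) ≤ E s := by
        have := sq_nonneg (x s - 2)
        simp only [hE, energy]
        linarith
      linarith [hpos s]
    have h6 := Real.exp_le_exp.2 h4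
    rw [Real.exp_log (by linarith [hpos s])] at h6
    linarith
  have hsmall : ∀ e, 0 < e → ∃ s, 0 ≤ s ∧ E s < e := by
    intro e he
    by_contra! hcon
    -- Chosen so that `ε(Y + 1/2) = 1/2`: the cross term then costs at most half of the dissipation
    -- `(x-2)²` and contributes `-(ε/2)(y-2)²`.
    set ε := 1 / (2 * Y + 1) with hε
    have hε0 : 0 < ε := by positivity
    have hεY : ε * (2 * Y + 1) = 1 := by rw [hε]; field_simp
    set C := 1 + 1 / m with hC
    have hC0 : 0 < C := by positivity
    have hEC : ∀ s, 0 ≤ s → E s ≤ C * ((x s - 2) ^ 2 + (y s - 2) ^ 2) := by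
      intro s hs
      have h1 := entropy_le (hpos s)
      have h2 : (y s - 2) ^ 2 / y s ≤ (y s - 2) ^ 2 / m :=
        div_le_div_of_nonneg_left (sq_nonneg _) hm0 (hm s hs)
      have h3 : (y s - 2) ^ 2 / m = 1 / m * (y s - 2) ^ 2 := by ring
      have h4 : 0 ≤ 1 / m * (x s - 2) ^ 2 := by positivity
      have h5 := sq_nonneg (x s - 2)
      have h6 := sq_nonneg (y s - 2)
      simp only [hE, energy, hC]
      linarith
    -- If the energy stayed above `e`, the perturbed energy would decrease at rate at least
    -- `(ε/2)(e/C)`. The linear term compensates exactly this rate, so `V` is nonincreasing, while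
    -- its other terms are bounded below.
    set V : ℝ → ℝ := fun s => E s + ε * ((2 - x s) * (y s - 2)) + (ε / 2 * (e / C)) * s with hV
    have hVd : ∀ s, HasDerivAt V (-(x s - 2) ^ 2 + ε * (-(y s - x s) * (y s - 2)
        + (2 - x s) * ((2 - x s) * y s)) + (ε / 2 * (e / C))) s := by
      intro s
      have h1 := (((hx s).const_sub 2).mul ((hy s).sub_const 2)).const_mul ε
      have h2 := (hasDerivAt_id s).const_mul (ε / 2 * (e / C))
      exact (((hEd s).add h1).add h2).congr_deriv (by ring)
    have hVanti : AntitoneOn V (Ici 0) := by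
      apply antitoneOn_of_deriv_nonpos (convex_Ici 0)
        (fun s _ => (hVd s).continuousAt.continuousWithinAt)
        (fun s _ => (hVd s).differentiableAt.differentiableWithinAt)
      intro s hs
      rw [interior_Ici] at hs
      have hs0 : 0 ≤ s := le_of_lt hs
      rw [(hVd s).deriv]
      have h1 : e / C ≤ (x s - 2) ^ 2 + (y s - 2) ^ 2 := by
        rw [div_le_iff₀' hC0]
        exact (hcon s hs0).trans (hEC s hs0)
      have h2 := mul_le_mul_of_nonneg_left h1 (show 0 ≤ ε / 2 by positivity)
      have h3 : ε * ((2 - x s) ^ 2 * y s) ≤ ε * ((2 - x s) ^ 2 * Y) := by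
        have := hY s hs0
        gcongr
      have h4 : 0 ≤ ε * (x s - 2 - (y s - 2)) ^ 2 := by positivity
      have h5 : ε * Y = (1 - ε) / 2 := by linarith
      have h6 : ε * ((2 - x s) ^ 2 * Y) = (1 - ε) / 2 * (2 - x s) ^ 2 := by rw [← h5]; ring
      nlinarith
    have hlow : ∀ s, 0 ≤ s → -(ε * (2 * E 0 + (Y + 2) ^ 2)) + (ε / 2 * (e / C)) * s ≤ V 0 := by
      intro s hs
      have h1 := hVanti (mem_Ici.2 le_rfl) (mem_Ici.2 hs) hs
      have h2 : -(2 * E 0 + (Y + 2) ^ 2) ≤ (2 - x s) * (y s - 2) := by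
        have := hxE s
        have := hanti hs
        have h3 : (y s - 2) ^ 2 ≤ (Y + 2) ^ 2 := by
          apply sq_le_sq'
          · linarith [hpos s]
          · linarith [hY s hs]
        nlinarith [sq_nonneg ((2 - x s) + (y s - 2)), sq_nonneg (x s - 2), sq_nonneg (y s - 2)]
      have h3 := mul_le_mul_of_nonneg_left h2 hε0.le
      have h4 := hE0 s
      simp only [hV] at h1 ⊢
      linarith
    have hδ : 0 < ε / 2 * (e / C) := by positivity
    obtain ⟨s, hs, hs0⟩ := (((tendsto_id.const_mul_atTop hδ).eventually_gt_atTop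
      (V 0 + ε * (2 * E 0 + (Y + 2) ^ 2))).and (eventually_ge_atTop 0)).exists
    have := hlow s hs0
    simp only [id] at hs
    linarith
  have hElim : Tendsto E atTop (𝓝 0) := by
    rw [Metric.tendsto_atTop]
    intro e he
    obtain ⟨s, _, hs⟩ := hsmall e he
    refine ⟨s, fun t ht => ?_⟩
    rw [Real.dist_eq, sub_zero, abs_of_nonneg (hE0 t)]
    exact (hanti ht).trans_lt hs
  have hxlim : Tendsto x atTop (𝓝 2) := by
    have h1 : Tendsto (fun s => (x s - 2) ^ 2) atTop (𝓝 0) :=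
      squeeze_zero (fun s => sq_nonneg _) hxE (by simpa using hElim.const_mul 2)
    simpa using (tendsto_zero_of_sq h1).add_const 2
  have hylim : Tendsto y atTop (𝓝 2) := by
    have h1 : Tendsto (fun s => (Real.sqrt (y s / 2) - 1) ^ 2) atTop (𝓝 0) :=
      squeeze_zero (fun s => sq_nonneg _) (fun s => by
        have := hyE s
        have := sq_nonneg (Real.sqrt (y s / 2) - 1)
        linarith) hElim
    have h3 : Tendsto (fun s => Real.sqrt (y s / 2) - 1 + 1) atTop (𝓝 (0 + 1)) :=
      (tendsto_zero_of_sq h1).add_const 1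
    simp only [sub_add_cancel, zero_add] at h3
    have h4 := (h3.pow 2).const_mul 2
    have h5 : (fun s => 2 * Real.sqrt (y s / 2) ^ 2) = y := by
      funext s
      rw [Real.sq_sqrt (by linarith [hpos s])]
      ring
    rw [h5] at h4
    simpa using h4
  exact hxlim.prodMk_nhds hylim

/-! ### The heteroclinic orbit -/

theorem admissible_exp : Admissible Real.exp where
  contDiff := Real.contDiff_exp
  pos := Real.exp_pos
  deriv_pos z := by rw [Real.deriv_exp]; exact Real.exp_pos z
  deriv_le z := by rw [Real.deriv_exp]

/-- Emden variables, with `q = e^{2s}`, i.e. radius `e^s`: `x` is the mass inside the radius divided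
by `4π` times the radius, and `y = q e^v`. The radial equation becomes autonomous, and regularity at
the origin gives the limit at `-∞`. -/
theorem IsRegularRadial.isHeteroclinic {a : ℝ} {v : ℝ → ℝ} (h : IsRegularRadial Real.exp a v) :
    IsHeteroclinic (fun s => -2 * Real.exp (2 * s) * deriv v (Real.exp (2 * s)))
      (fun s => Real.exp (2 * s) * Real.exp (v (Real.exp (2 * s)))) := by
  have hv := h.contDiff
  have hv' : ContDiff ℝ 1 (deriv v) := by
    have h2 : (2 : WithTop ℕ∞) = 1 + 1 := by norm_num
    rw [h2, contDiff_succ_iff_deriv] at hv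
    exact hv.2.2
  have hq : ∀ s : ℝ, HasDerivAt (fun s : ℝ => Real.exp (2 * s)) (2 * Real.exp (2 * s)) s := fun s => by
    have := ((hasDerivAt_id s).const_mul 2).exp
    exact this.congr_deriv (by simp; ring)
  have hdv : ∀ q, HasDerivAt v (deriv v q) q := fun q =>
    (hv.differentiable two_ne_zero).differentiableAt.hasDerivAt
  have hddv : ∀ q, HasDerivAt (deriv v) (deriv (deriv v) q) q := fun q =>
    (hv'.differentiable one_ne_zero).differentiableAt.hasDerivAt
  have hdx : ∀ s, HasDerivAt (fun s => -2 * Real.exp (2 * s) * deriv v (Real.exp (2 * s)))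
      (Real.exp (2 * s) * Real.exp (v (Real.exp (2 * s)))
        - -2 * Real.exp (2 * s) * deriv v (Real.exp (2 * s))) s := fun s => by
    have h1 := ((hq s).const_mul (-2)).mul ((hddv (Real.exp (2 * s))).comp s (hq s))
    refine h1.congr_deriv ?_
    have h2 := h.ode (Real.exp (2 * s)) (Real.exp_pos _).le
    simp only [Function.comp_apply]
    linear_combination -Real.exp (2 * s) * h2
  have hdy : ∀ s, HasDerivAt (fun s => Real.exp (2 * s) * Real.exp (v (Real.exp (2 * s))))
      ((2 - -2 * Real.exp (2 * s) * deriv v (Real.exp (2 * s)))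
        * (Real.exp (2 * s) * Real.exp (v (Real.exp (2 * s))))) s := fun s => by
    have h1 := (hq s).mul (((hdv (Real.exp (2 * s))).comp s (hq s)).exp)
    refine h1.congr_deriv ?_
    simp only [Function.comp_apply]
    ring
  refine ⟨hdx, hdy, ?_, tendsto_equilibrium hdx hdy fun s => by positivity⟩
  have hlim : Tendsto (fun s : ℝ => Real.exp (2 * s)) atBot (𝓝 0) :=
    Real.tendsto_exp_atBot.comp (tendsto_id.const_mul_atBot two_pos)
  have h0 := hv.continuous
  have h1 := hv'.continuous
  have hc : Continuous fun q => (-2 * q * deriv v q, q * Real.exp (v q)) := by fun_prop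
  have h2 := (hc.tendsto 0).comp hlim
  simp only [mul_zero, zero_mul] at h2
  exact h2

namespace IsHeteroclinic

variable {x y : ℝ → ℝ}

theorem continuous_x (h : IsHeteroclinic x y) : Continuous x :=
  continuous_iff_continuousAt.2 fun s => (h.deriv_x s).continuousAt

theorem continuous_y (h : IsHeteroclinic x y) : Continuous y :=
  continuous_iff_continuousAt.2 fun s => (h.deriv_y s).continuousAt

theorem tendsto_x_atBot (h : IsHeteroclinic x y) : Tendsto x atBot (𝓝 0) :=
  (continuous_fst.tendsto _).comp h.tendsto_atBot

theorem tendsto_y_atBot (h : IsHeteroclinic x y) : Tendsto y atBot (𝓝 0) :=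
  (continuous_snd.tendsto _).comp h.tendsto_atBot

theorem tendsto_x_atTop (h : IsHeteroclinic x y) : Tendsto x atTop (𝓝 2) :=
  (continuous_fst.tendsto _).comp h.tendsto_atTop

theorem tendsto_y_atTop (h : IsHeteroclinic x y) : Tendsto y atTop (𝓝 2) :=
  (continuous_snd.tendsto _).comp h.tendsto_atTop

/-- The integrating factor `exp(-∫(2-x))` makes `y` a constant multiple of a positive function; the
sign is read off from the limit `2`. -/
theorem y_pos (h : IsHeteroclinic x y) (s : ℝ) : 0 < y s := by
  have hc : Continuous fun s => 2 - x s := continuous_const.sub h.continuous_x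
  set A : ℝ → ℝ := fun s => ∫ t in (0 : ℝ)..s, (2 - x t) with hA
  have hAd : ∀ s, HasDerivAt A (2 - x s) s := fun s =>
    intervalIntegral.integral_hasDerivAt_right (hc.intervalIntegrable 0 s)
      (hc.stronglyMeasurableAtFilter _ _) hc.continuousAt
  have hd : ∀ s, HasDerivAt (fun s => y s * Real.exp (-A s)) 0 s := fun s =>
    ((h.deriv_y s).mul (hAd s).neg.exp).congr_deriv (by ring)
  have hconst := is_const_of_deriv_eq_zero (fun s => (hd s).differentiableAt) fun s => (hd s).deriv
  obtain ⟨t, ht⟩ := (h.tendsto_y_atTop.eventually (lt_mem_nhds two_pos)).exists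
  have h1 : 0 < y s * Real.exp (-A s) := by
    rw [hconst s t]
    positivity
  exact pos_of_mul_pos_left h1 (Real.exp_pos _).le

theorem hasDerivAt_exp_mul_x (h : IsHeteroclinic x y) (s : ℝ) :
    HasDerivAt (fun s => Real.exp s * x s) (Real.exp s * y s) s :=
  ((Real.hasDerivAt_exp s).mul (h.deriv_x s)).congr_deriv (by ring)

theorem x_pos (h : IsHeteroclinic x y) (s : ℝ) : 0 < x s := by
  have hmono : StrictMono fun s => Real.exp s * x s := strictMono_of_deriv_pos fun s => by
    rw [(h.hasDerivAt_exp_mul_x s).deriv]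
    exact mul_pos (Real.exp_pos s) (h.y_pos s)
  have hlim : Tendsto (fun s => Real.exp s * x s) atBot (𝓝 0) := by
    simpa using Real.tendsto_exp_atBot.mul h.tendsto_x_atBot
  have h1 : 0 < Real.exp s * x s :=
    (hmono.monotone.le_of_tendsto hlim (s - 1)).trans_lt (hmono (by linarith))
  exact pos_of_mul_pos_right h1 (Real.exp_pos s).le

theorem hasDerivAt_log_sub (h : IsHeteroclinic x y) (s : ℝ) :
    HasDerivAt (fun s => Real.log (y s) - 2 * s) (-x s) s := by
  have := ((h.deriv_y s).log (h.y_pos s).ne').sub ((hasDerivAt_id s).const_mul 2)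
  refine this.congr_deriv ?_
  have := (h.y_pos s).ne'
  field_simp
  ring

/-- The potential converges at the origin of the spiral. -/
theorem exists_tendsto_log_sub (h : IsHeteroclinic x y) :
    ∃ a, Tendsto (fun s => Real.log (y s) - 2 * s) atBot (𝓝 a) := by
  have hanti : Antitone fun s => Real.log (y s) - 2 * s :=
    antitone_of_deriv_nonpos (fun s => (h.hasDerivAt_log_sub s).differentiableAt) fun s => by
      rw [(h.hasDerivAt_log_sub s).deriv]
      linarith [h.x_pos s]
  obtain ⟨s₀, hs₀⟩ := eventually_atBot.1
    (h.tendsto_x_atBot.eventually (gt_mem_nhds (show (0 : ℝ) < 1 by norm_num)))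
  -- The potential `log y - 2s` is monotone, so only a bound near `-∞` is missing. Adding `y - x`
  -- reverses the monotonicity where `x < 1`, and this correction is bounded there by the signs and
  -- size of `x` and `y`.
  have hd : ∀ s, HasDerivAt (fun s => Real.log (y s) - 2 * s - x s + y s) ((1 - x s) * y s) s :=
    fun s => (((h.hasDerivAt_log_sub s).sub (h.deriv_x s)).add (h.deriv_y s)).congr_deriv (by ring)
  have hmono : MonotoneOn (fun s => Real.log (y s) - 2 * s - x s + y s) (Iic s₀) := by
    apply monotoneOn_of_deriv_nonneg (convex_Iic s₀)
      (fun s _ => (hd s).continuousAt.continuousWithinAt)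
      (fun s _ => (hd s).differentiableAt.differentiableWithinAt)
    intro s hs
    rw [interior_Iic] at hs
    rw [(hd s).deriv]
    exact mul_nonneg (by linarith [hs₀ s (le_of_lt hs)]) (h.y_pos s).le
  have hbdd : BddAbove (range fun s => Real.log (y s) - 2 * s) := by
    refine ⟨Real.log (y s₀) - 2 * s₀ - x s₀ + y s₀ + 1, ?_⟩
    rintro _ ⟨s, rfl⟩
    have h1 := hmono (mem_Iic.2 (min_le_right s s₀)) (mem_Iic.2 le_rfl) (min_le_right s s₀)
    have h2 := hs₀ _ (min_le_right s s₀)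
    have h3 := h.y_pos (min s s₀)
    have h4 := hanti (min_le_left s s₀)
    simp only at h1 h4 ⊢
    linarith
  exact ⟨_, tendsto_atBot_ciSup hanti hbdd⟩

/-- The inverse Emden change of variables, for an arbitrary parametrization of the orbit. It
transfers uniqueness of radial solutions to heteroclinic orbits. -/
theorem isRadial (h : IsHeteroclinic x y) {a : ℝ}
    (ha : Tendsto (fun s => Real.log (y s) - 2 * s) atBot (𝓝 a)) :
    IsRadial Real.exp a
      (fun q => if q ≤ 0 then a else Real.log (y (Real.log q / 2)) - 2 * (Real.log q / 2)) := by
  set v : ℝ → ℝ := fun q =>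
    if q ≤ 0 then a else Real.log (y (Real.log q / 2)) - 2 * (Real.log q / 2) with hv
  have hvpos : ∀ q, 0 < q → v q = Real.log (y (Real.log q / 2)) - 2 * (Real.log q / 2) :=
    fun q hq => if_neg (not_le.2 hq)
  have hev : ∀ q, 0 < q → v =ᶠ[𝓝 q] fun q => Real.log (y (Real.log q / 2)) - 2 * (Real.log q / 2) :=
    fun q hq => by filter_upwards [lt_mem_nhds hq] with p hp using hvpos p hp
  have hd : ∀ q, 0 < q → HasDerivAt v (-x (Real.log q / 2) * (q⁻¹ / 2)) q := fun q hq => by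
    have h1 := (h.hasDerivAt_log_sub (Real.log q / 2)).comp q
      ((Real.hasDerivAt_log hq.ne').div_const 2)
    exact h1.congr_of_eventuallyEq (hev q hq)
  have hlog : Tendsto (fun q => Real.log q / 2) (𝓝[>] 0) atBot :=
    Real.tendsto_log_nhdsGT_zero.atBot_div_const two_pos
  have hcont : ContinuousOn v (Ici 0) := by
    intro q hq
    rcases eq_or_lt_of_le (mem_Ici.1 hq) with rfl | hq
    · rw [← continuousWithinAt_Ioi_iff_Ici, ContinuousWithinAt, show v 0 = a from if_pos le_rfl]
      refine (ha.comp hlog).congr' ?_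
      filter_upwards [self_mem_nhdsWithin] with p hp using (hvpos p hp).symm
    · exact (hd q hq).continuousAt.continuousWithinAt
  refine ⟨hcont, if_pos le_rfl, fun q hq => (hd q hq).congr_deriv ?_⟩
  set σ := Real.log q / 2 with hσ
  have hint : ∀ t, 0 < t → t ^ 2 * Real.exp (v (q * t ^ 2)) = y (σ + Real.log t) / q := by
    intro t ht
    have hqt : 0 < q * t ^ 2 := by positivity
    have h1 : Real.log (q * t ^ 2) / 2 = σ + Real.log t := by
      rw [Real.log_mul hq.ne' (by positivity), Real.log_pow]
      push_cast
      rw [hσ]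
      ring
    rw [hvpos _ hqt, Real.exp_sub, Real.exp_log (h.y_pos _), mul_div_cancel₀ _ two_ne_zero,
      Real.exp_log hqt, h1]
    field_simp
  -- The equation `x' = y - x` says that `t · x(σ + log t)/q` is a primitive of the integrand; it
  -- vanishes at `t = 0` because `x → 0` at `-∞`.
  have hFTC : radialMean (fun s => Real.exp (v s)) q = x σ / q := by
    have h1 := intervalIntegral.integral_eq_sub_of_hasDerivAt_of_le (a := 0) (b := 1) zero_le_one
      (f := fun t => t * (x (σ + Real.log t) / q))
      (f' := fun t => t ^ 2 * Real.exp (v (q * t ^ 2))) ?_ (fun t ht => ?_)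
      (intervalIntegrable_radialMean (Real.continuous_exp.comp_continuousOn hcont) hq.le)
    · rw [radialMean, h1]
      simp
    · intro t ht
      rcases eq_or_lt_of_le ht.1 with rfl | ht0
      · apply ContinuousWithinAt.mono _ Icc_subset_Ici_self
        rw [← continuousWithinAt_Ioi_iff_Ici, ContinuousWithinAt, zero_mul]
        have h2 : Tendsto (fun t => x (σ + Real.log t) / q) (𝓝[>] 0) (𝓝 (0 / q)) :=
          (h.tendsto_x_atBot.comp
            (tendsto_atBot_add_const_left _ σ Real.tendsto_log_nhdsGT_zero)).div_const q
        have h3 : Tendsto (fun t : ℝ => t) (𝓝[>] 0) (𝓝 0) := tendsto_id.mono_left nhdsWithin_le_nhds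
        simpa using h3.mul h2
      · have h2 : ContinuousAt (fun t => x (σ + Real.log t)) t :=
          h.continuous_x.continuousAt.comp
            (continuousAt_const.add (Real.continuousAt_log ht0.ne'))
        exact (continuousAt_id.mul (h2.div_const q)).continuousWithinAt
    · have ht0 : t ≠ 0 := ht.1.ne'
      have h2 : HasDerivAt (fun t => σ + Real.log t) t⁻¹ t := (Real.hasDerivAt_log ht0).const_add σ
      have h3 := (hasDerivAt_id t).mul (((h.deriv_x (σ + Real.log t)).comp t h2).div_const q)
      refine h3.congr_deriv ?_
      rw [hint t ht.1]
      simp only [id, Function.comp_apply]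
      field_simp
      ring
  rw [hFTC]
  field_simp

theorem comp_add_const (h : IsHeteroclinic x y) (c : ℝ) :
    IsHeteroclinic (fun s => x (s + c)) (fun s => y (s + c)) where
  deriv_x s := (h.deriv_x (s + c)).comp_add_const s c
  deriv_y s := (h.deriv_y (s + c)).comp_add_const s c
  tendsto_atBot := h.tendsto_atBot.comp (tendsto_atBot_add_const_right _ c tendsto_id)
  tendsto_atTop := h.tendsto_atTop.comp (tendsto_atTop_add_const_right _ c tendsto_id)

/-- The limit `a` is the central value of the associated radial solution, which is unique, so `y₁ =
y₂`; then `x` is recovered from `y'/y = 2 - x`. -/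
theorem eq_of_tendsto_eq {x₁ y₁ x₂ y₂ : ℝ → ℝ} (h₁ : IsHeteroclinic x₁ y₁)
    (h₂ : IsHeteroclinic x₂ y₂) {a : ℝ}
    (ha₁ : Tendsto (fun s => Real.log (y₁ s) - 2 * s) atBot (𝓝 a))
    (ha₂ : Tendsto (fun s => Real.log (y₂ s) - 2 * s) atBot (𝓝 a)) : x₁ = x₂ := by
  have hy : y₁ = y₂ := by
    funext s
    have hq := Real.exp_pos (2 * s)
    have h3 := admissible_exp.isRadial_unique (h₁.isRadial ha₁) (h₂.isRadial ha₂) hq.le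
    rw [if_neg (not_le.2 hq), if_neg (not_le.2 hq), Real.log_exp,
      mul_div_cancel_left₀ _ two_ne_zero, sub_left_inj] at h3
    exact Real.log_injOn_pos (h₁.y_pos s) (h₂.y_pos s) h3
  funext s
  have h3 := (h₁.deriv_y s).unique (hy ▸ h₂.deriv_y s)
  have h4 := mul_right_cancel₀ (h₁.y_pos s).ne' h3
  linarith

/-- The heteroclinic orbit is unique up to a translation. -/
theorem eq_translate {x₁ y₁ x₂ y₂ : ℝ → ℝ} (h₁ : IsHeteroclinic x₁ y₁)
    (h₂ : IsHeteroclinic x₂ y₂) {a₁ a₂ : ℝ}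
    (ha₁ : Tendsto (fun s => Real.log (y₁ s) - 2 * s) atBot (𝓝 a₁))
    (ha₂ : Tendsto (fun s => Real.log (y₂ s) - 2 * s) atBot (𝓝 a₂)) (s : ℝ) :
    x₁ s = x₂ (s + (a₁ - a₂) / 2) := by
  refine congrFun (h₁.eq_of_tendsto_eq (h₂.comp_add_const ((a₁ - a₂) / 2)) ha₁ ?_) s
  have h3 := (ha₂.comp (tendsto_atBot_add_const_right _ ((a₁ - a₂) / 2) tendsto_id)).add_const
    (a₁ - a₂)
  rw [add_sub_cancel] at h3
  refine h3.congr fun s => ?_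
  simp only [Function.comp_apply, id]
  ring

end IsHeteroclinic

/-- Scaling invariance of the exponential: the solution with central value `2s`, seen at radius `1`,
is the one with central value `0` seen at radius `e^s`. A single orbit thus describes all masses. -/
theorem exists_isHeteroclinic_radialMass :
    ∃ x y : ℝ → ℝ, IsHeteroclinic x y ∧ ∀ s, radialMass Real.exp (2 * s) = x s := by
  have hlim : ∀ {a : ℝ} {v : ℝ → ℝ}, IsRegularRadial Real.exp a v →
      Tendsto (fun s => Real.log (Real.exp (2 * s) * Real.exp (v (Real.exp (2 * s)))) - 2 * s)
        atBot (𝓝 a) := by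
    intro a v h
    have h1 : Tendsto (fun s : ℝ => Real.exp (2 * s)) atBot (𝓝 0) :=
      Real.tendsto_exp_atBot.comp (tendsto_id.const_mul_atBot two_pos)
    have h2 := (h.contDiff.continuous.tendsto 0).comp h1
    rw [h.zero] at h2
    refine h2.congr fun s => ?_
    rw [← Real.exp_add, Real.log_exp]
    simp
  have h0 := admissible_exp.radialSolution_spec 0
  refine ⟨_, _, h0.isHeteroclinic, fun s => ?_⟩
  have hs := admissible_exp.radialSolution_spec (2 * s)
  have h1 := hs.isHeteroclinic.eq_translate h0.isHeteroclinic (hlim hs) (hlim h0) 0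
  have h2 := hs.deriv_eq 1 zero_le_one
  rw [radialMass]
  simp only [mul_zero, Real.exp_zero, zero_add, sub_zero, mul_div_cancel_left₀ _ (two_ne_zero' ℝ)]
    at h1
  rw [← h1, h2]
  ring

/-! ### Zeros of functions of one variable -/

theorem exists_enumeration_of_locally_finite {Z : Set ℝ} (hfin : ∀ a b, (Z ∩ Icc a b).Finite)
    (hbelow : BddBelow Z) (habove : ¬BddAbove Z) : ∃ z : ℕ → ℝ, StrictMono z ∧ range z = Z := by
  have hIcc : ∀ a b : Z, (Icc a b).Finite := fun a b => by
    refine Finite.of_finite_image ((hfin a b).subset ?_) Subtype.val_injective.injOn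
    rintro _ ⟨c, hc, rfl⟩
    exact ⟨c.2, hc⟩
  have hunb : ∀ s : ℝ, ∃ t ∈ Z, s < t := fun s => by
    by_contra! h
    exact habove ⟨s, fun t ht => h t ht⟩
  obtain ⟨m, hm⟩ := hbelow
  obtain ⟨t₀, ht₀, -⟩ := hunb 0
  obtain ⟨b, hb, hbmin⟩ := (hfin m t₀).exists_minimalFor id _ ⟨t₀, ht₀, hm ht₀, le_rfl⟩
  let _ : LocallyFiniteOrder Z := LocallyFiniteOrder.ofFiniteIcc hIcc
  let _ : SuccOrder Z := LinearLocallyFiniteOrder.succOrder Z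
  let _ : PredOrder Z := LinearLocallyFiniteOrder.predOrder Z
  let _ : OrderBot Z :=
    { bot := ⟨b, hb.1⟩
      bot_le := fun c => by
        change b ≤ (c : ℝ)
        rcases le_total (c : ℝ) b with h | h
        · exact hbmin ⟨c.2, hm c.2, h.trans hb.2.2⟩ h
        · exact h }
  have : NoMaxOrder Z := ⟨fun a => by
    obtain ⟨t, ht, hat⟩ := hunb a
    exact ⟨⟨t, ht⟩, hat⟩⟩
  let e : Z ≃o ℕ := orderIsoNatOfLinearSuccPredArch
  refine ⟨fun n => (e.symm n : ℝ), fun i j hij => e.symm.strictMono hij, ?_⟩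
  ext t
  constructor
  · rintro ⟨n, rfl⟩
    exact (e.symm n).2
  · intro ht
    exact ⟨e ⟨t, ht⟩, by simp⟩

/-- Simple zeros are isolated, and an infinite subset of a compact interval accumulates. -/
theorem finite_zeros_inter_Icc {f f' : ℝ → ℝ} (hf : ∀ s, HasDerivAt f (f' s) s)
    (hf' : ∀ s, f s = 0 → f' s ≠ 0) (a b : ℝ) : ({s | f s = 0} ∩ Icc a b).Finite := by
  by_contra hinf
  obtain ⟨s, -, hs⟩ := Set.Infinite.exists_accPt_of_subset_isCompact hinf isCompact_Icc
    inter_subset_right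
  rw [accPt_iff_frequently] at hs
  refine hs ?_
  have hne : ∀ᶠ t in 𝓝[≠] s, f t ≠ 0 := by
    by_cases h0 : f s = 0
    · simpa [h0] using (hf s).eventually_ne (hf' s h0)
    · exact nhdsWithin_le_nhds ((hf s).continuousAt.eventually_ne h0)
  rw [eventually_nhdsWithin_iff] at hne
  filter_upwards [hne] with t ht htc
  exact ht htc.1 htc.2.1

theorem eventually_pos_right_and_neg_left {f : ℝ → ℝ} {f' a : ℝ} (hf : HasDerivAt f f' a)
    (h0 : f a = 0) (hpos : 0 < f') : (∀ᶠ s in 𝓝[>] a, 0 < f s) ∧ ∀ᶠ s in 𝓝[<] a, f s < 0 := by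
  have h := eventually_nhdsWithin_sign_eq_of_deriv_pos (f := f) (by rwa [hf.deriv]) h0
  constructor
  · filter_upwards [nhdsWithin_le_nhds h, self_mem_nhdsWithin] with s hs has
    rw [sign_pos (sub_pos.2 has)] at hs
    exact sign_eq_one_iff.1 hs
  · filter_upwards [nhdsWithin_le_nhds h, self_mem_nhdsWithin] with s hs has
    rw [sign_neg (sub_neg.2 has)] at hs
    exact sign_eq_neg_one_iff.1 hs

theorem pos_of_ordConnected_of_ne_zero {f : ℝ → ℝ} {S : Set ℝ} (hS : S.OrdConnected) (hf : Continuous f)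
    (hne : ∀ s ∈ S, f s ≠ 0) {t : ℝ} (ht : t ∈ S) (hpos : 0 < f t) : ∀ s ∈ S, 0 < f s := by
  intro s hs
  by_contra! hle
  obtain ⟨r, hr, hr0⟩ := hS.isPreconnected.intermediate_value hs ht hf.continuousOn ⟨hle, hpos.le⟩
  exact hne r hr hr0

/-- A function that leaves a zero upwards stays positive up to the next zero, so it cannot cross
that zero upwards. -/
theorem deriv_neg_of_consecutive_zeros {f : ℝ → ℝ} {a b a' b' : ℝ} (hf : Continuous f)
    (hab : a < b) (ha : HasDerivAt f a' a) (hb : HasDerivAt f b' b) (ha0 : f a = 0) (hb0 : f b = 0)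
    (hb' : b' ≠ 0) (hne : ∀ s ∈ Ioo a b, f s ≠ 0) (hpos : 0 < a') : b' < 0 := by
  obtain ⟨t, ht, htab⟩ := ((eventually_pos_right_and_neg_left ha ha0 hpos).1.and
    (Ioo_mem_nhdsGT hab)).exists
  have h := pos_of_ordConnected_of_ne_zero ordConnected_Ioo hf hne htab ht
  by_contra! hb1
  obtain ⟨r, hr, hrab⟩ := ((eventually_pos_right_and_neg_left hb hb0
    (lt_of_le_of_ne hb1 hb'.symm)).2.and (Ioo_mem_nhdsLT hab)).exists
  exact absurd (h r hrab) (not_lt.2 hr.le)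

theorem deriv_mul_neg_of_consecutive_zeros {f : ℝ → ℝ} {a b a' b' : ℝ} (hf : Continuous f)
    (hab : a < b) (ha : HasDerivAt f a' a) (hb : HasDerivAt f b' b) (ha0 : f a = 0) (hb0 : f b = 0)
    (ha' : a' ≠ 0) (hb' : b' ≠ 0) (hne : ∀ s ∈ Ioo a b, f s ≠ 0) : a' * b' < 0 := by
  rcases lt_or_gt_of_ne ha' with h | h
  · have := deriv_neg_of_consecutive_zeros hf.neg hab ha.neg hb.neg (by simp [ha0]) (by simp [hb0])
      (neg_ne_zero.2 hb') (fun s hs => neg_ne_zero.2 (hne s hs)) (by linarith)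
    nlinarith
  · have := deriv_neg_of_consecutive_zeros hf hab ha hb ha0 hb0 hb' hne h
    nlinarith

theorem lt_of_tendsto_of_deriv_pos {f f' : ℝ → ℝ} {S l : ℝ} (hf : ∀ s, HasDerivAt f (f' s) s)
    (hpos : ∀ s, S < s → 0 < f' s) (hl : Tendsto f atTop (𝓝 l)) {s : ℝ} (hs : S < s) : f s < l := by
  have hmono : StrictMonoOn f (Ici s) := by
    apply strictMonoOn_of_deriv_pos (convex_Ici s)
      (fun t _ => (hf t).continuousAt.continuousWithinAt)
    intro t ht
    rw [interior_Ici] at ht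
    rw [(hf t).deriv]
    exact hpos t (hs.trans ht)
  refine (hmono self_mem_Ici (show s ≤ s + 1 by linarith) (by linarith : s < s + 1)).trans_le ?_
  refine ge_of_tendsto hl ?_
  filter_upwards [eventually_ge_atTop (s + 1)] with t ht
  exact hmono.monotoneOn (show s ≤ s + 1 by linarith) (show s ≤ t by linarith) ht

/-! ### Turning points of the spiral -/

namespace IsHeteroclinic

variable {x y : ℝ → ℝ}

theorem hasDerivAt_energy (h : IsHeteroclinic x y) (s : ℝ) :
    HasDerivAt (fun s => energy (x s) (y s)) (-(x s - 2) ^ 2) s :=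
  _root_.hasDerivAt_energy (h.deriv_x s) (h.deriv_y s) (h.y_pos s)

theorem antitone_energy (h : IsHeteroclinic x y) : Antitone fun s => energy (x s) (y s) :=
  antitone_of_deriv_nonpos (fun s => (h.hasDerivAt_energy s).differentiableAt)
    fun s => by rw [(h.hasDerivAt_energy s).deriv]; nlinarith [sq_nonneg (x s - 2)]

/-- Backward uniqueness at the equilibrium: `E' = -(x-2)² ≥ -2E`, so `E e^{2s}` is nondecreasing. A
zero of `E` would propagate to all earlier times and force `x = 2` there, against `x → 0`. -/
theorem energy_ne_zero (h : IsHeteroclinic x y) (s : ℝ) : energy (x s) (y s) ≠ 0 := by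
  intro h0
  have hx : ∀ t, (x t - 2) ^ 2 ≤ 2 * energy (x t) (y t) := by
    intro t
    have h1 := sq_sqrt_half_sub_one_le (h.y_pos t)
    have h2 := sq_nonneg (Real.sqrt (y t / 2) - 1)
    unfold energy
    linarith
  have hd : ∀ t, HasDerivAt (fun t => energy (x t) (y t) * Real.exp (2 * t))
      ((2 * energy (x t) (y t) - (x t - 2) ^ 2) * Real.exp (2 * t)) t := fun t =>
    ((h.hasDerivAt_energy t).mul ((hasDerivAt_id t).const_mul 2).exp).congr_deriv
      (by simp only [id]; ring)
  have hmono : Monotone fun t => energy (x t) (y t) * Real.exp (2 * t) :=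
    monotone_of_deriv_nonneg (fun t => (hd t).differentiableAt) fun t => by
      rw [(hd t).deriv]
      exact mul_nonneg (by linarith [hx t]) (Real.exp_pos _).le
  obtain ⟨t, ht, hts⟩ := ((h.tendsto_x_atBot.eventually (gt_mem_nhds (show (0 : ℝ) < 1 by
    norm_num))).and (eventually_le_atBot s)).exists
  have h1 := hmono hts
  simp only [h0, zero_mul] at h1
  have h2 : energy (x t) (y t) ≤ 0 := by
    by_contra! h3
    exact absurd h1 (not_le.2 (by positivity))
  nlinarith [hx t]

theorem ne_two_of_critical (h : IsHeteroclinic x y) {s : ℝ} (hs : y s - x s = 0) : x s ≠ 2 := by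
  intro h2
  have hy : y s = 2 := by linarith
  exact h.energy_ne_zero s (by simp [energy, h2, hy])

/-- Equal values would make the energy constant on an interval, hence `x = 2` and `x' = 0` there,
which is the equilibrium. -/
theorem strictAnti_energy (h : IsHeteroclinic x y) : StrictAnti fun s => energy (x s) (y s) := by
  intro s t hst
  refine lt_of_le_of_ne (h.antitone_energy hst.le) fun heq => ?_
  have hconst : ∀ r ∈ Ioo s t, (fun r => energy (x r) (y r)) =ᶠ[𝓝 r] fun _ => energy (x s) (y s) := by
    intro r hr
    filter_upwards [Ioo_mem_nhds hr.1 hr.2] with p hp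
    exact le_antisymm (h.antitone_energy hp.1.le) (heq.symm.le.trans (h.antitone_energy hp.2.le))
  have hx : ∀ r ∈ Ioo s t, x r = 2 := by
    intro r hr
    have h1 := (h.hasDerivAt_energy r).unique
      ((hasDerivAt_const r _).congr_of_eventuallyEq (hconst r hr))
    nlinarith
  obtain ⟨r, hr⟩ := nonempty_Ioo.2 hst
  have h1 : x =ᶠ[𝓝 r] fun _ => 2 := by
    filter_upwards [Ioo_mem_nhds hr.1 hr.2] with p hp using hx p hp
  exact h.ne_two_of_critical ((h.deriv_x r).unique
    ((hasDerivAt_const r (2 : ℝ)).congr_of_eventuallyEq h1)) (hx r hr)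

theorem hasDerivAt_speed (h : IsHeteroclinic x y) (s : ℝ) :
    HasDerivAt (fun s => y s - x s) ((2 - x s) * y s - (y s - x s)) s :=
  (h.deriv_y s).sub (h.deriv_x s)

theorem deriv_x_eq (h : IsHeteroclinic x y) : deriv x = fun s => y s - x s :=
  funext fun s => (h.deriv_x s).deriv

theorem deriv_speed_ne_zero (h : IsHeteroclinic x y) {s : ℝ} (hs : y s - x s = 0) :
    (2 - x s) * y s - (y s - x s) ≠ 0 := by
  rw [hs, sub_zero]
  exact mul_ne_zero (sub_ne_zero.2 (h.ne_two_of_critical hs).symm) (h.y_pos s).ne'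

theorem isLocalMin_of_critical (h : IsHeteroclinic x y) {s : ℝ} (hs : y s - x s = 0)
    (h2 : x s < 2) : IsLocalMin x s := by
  apply isLocalMin_of_deriv_deriv_pos _ (by rw [h.deriv_x_eq]; exact hs) h.continuous_x.continuousAt
  rw [h.deriv_x_eq, (h.hasDerivAt_speed s).deriv, hs, sub_zero]
  exact mul_pos (by linarith) (h.y_pos s)

theorem isLocalMax_of_critical (h : IsHeteroclinic x y) {s : ℝ} (hs : y s - x s = 0)
    (h2 : 2 < x s) : IsLocalMax x s := by
  apply isLocalMax_of_deriv_deriv_neg _ (by rw [h.deriv_x_eq]; exact hs) h.continuous_x.continuousAt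
  rw [h.deriv_x_eq, (h.hasDerivAt_speed s).deriv, hs, sub_zero]
  exact mul_neg_of_neg_of_pos (by linarith) (h.y_pos s)

theorem not_isLocalMin_and_isLocalMax (h : IsHeteroclinic x y) {s : ℝ} (hmin : IsLocalMin x s)
    (hmax : IsLocalMax x s) : False := by
  have h1 : x =ᶠ[𝓝 s] fun _ => x s := by
    filter_upwards [hmin, hmax] with t h1 h2 using le_antisymm h2 h1
  have h2 : (fun s => y s - x s) =ᶠ[𝓝 s] fun _ => 0 := by
    have := h1.deriv
    rw [h.deriv_x_eq] at this
    simpa using this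
  exact h.deriv_speed_ne_zero h2.eq_of_nhds
    ((h.hasDerivAt_speed s).unique ((hasDerivAt_const s (0 : ℝ)).congr_of_eventuallyEq h2))

theorem isLocalMin_iff (h : IsHeteroclinic x y) (s : ℝ) :
    IsLocalMin x s ↔ y s - x s = 0 ∧ x s < 2 := by
  refine ⟨fun hmin => ?_, fun hs => h.isLocalMin_of_critical hs.1 hs.2⟩
  have hs := hmin.hasDerivAt_eq_zero (h.deriv_x s)
  refine ⟨hs, lt_of_not_ge fun hge => ?_⟩
  exact h.not_isLocalMin_and_isLocalMax hmin
    (h.isLocalMax_of_critical hs (lt_of_le_of_ne hge (h.ne_two_of_critical hs).symm))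

theorem isLocalMax_iff (h : IsHeteroclinic x y) (s : ℝ) :
    IsLocalMax x s ↔ y s - x s = 0 ∧ 2 < x s := by
  refine ⟨fun hmax => ?_, fun hs => h.isLocalMax_of_critical hs.1 hs.2⟩
  have hs := hmax.hasDerivAt_eq_zero (h.deriv_x s)
  refine ⟨hs, lt_of_not_ge fun hge => ?_⟩
  exact h.not_isLocalMin_and_isLocalMax
    (h.isLocalMin_of_critical hs (lt_of_le_of_ne hge (h.ne_two_of_critical hs))) hmax

/-- The mass increases near `-∞`. -/
theorem exists_speed_pos (h : IsHeteroclinic x y) : ∃ s₀, ∀ s ≤ s₀, 0 < y s - x s := by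
  obtain ⟨s₀, hs₀⟩ := eventually_atBot.1
    (h.tendsto_x_atBot.eventually (gt_mem_nhds (show (0 : ℝ) < 2 by norm_num)))
  have hd : ∀ s, HasDerivAt (fun s => Real.exp s * (y s - x s)) (Real.exp s * ((2 - x s) * y s)) s :=
    fun s => ((Real.hasDerivAt_exp s).mul (h.hasDerivAt_speed s)).congr_deriv (by ring)
  have hmono : StrictMonoOn (fun s => Real.exp s * (y s - x s)) (Iic s₀) := by
    apply strictMonoOn_of_deriv_pos (convex_Iic s₀)
      (fun t _ => (hd t).continuousAt.continuousWithinAt)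
    intro t ht
    rw [interior_Iic] at ht
    rw [(hd t).deriv]
    exact mul_pos (Real.exp_pos t) (mul_pos (by linarith [hs₀ t (le_of_lt ht)]) (h.y_pos t))
  have hlim : Tendsto (fun s => Real.exp s * (y s - x s)) atBot (𝓝 0) := by
    simpa using Real.tendsto_exp_atBot.mul (h.tendsto_y_atBot.sub h.tendsto_x_atBot)
  refine ⟨s₀, fun s hs => ?_⟩
  have h1 : 0 ≤ Real.exp (s - 1) * (y (s - 1) - x (s - 1)) := by
    refine le_of_tendsto hlim ?_
    filter_upwards [eventually_le_atBot (s - 1)] with t ht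
    exact hmono.monotoneOn (show t ≤ s₀ by linarith) (show s - 1 ≤ s₀ by linarith) ht
  have h2 : 0 < Real.exp s * (y s - x s) :=
    h1.trans_lt (hmono (show s - 1 ≤ s₀ by linarith) hs (by linarith : s - 1 < s))
  exact pos_of_mul_pos_right h2 (Real.exp_pos s).le

/-- The orbit cannot approach the equilibrium inside one quadrant. -/
theorem not_eventually_same_sign (h : IsHeteroclinic x y) {S : ℝ}
    (hS : ∀ s, S < s → 0 < (2 - y s) / (2 - x s)) : False := by
  obtain ⟨S', hS'⟩ := eventually_atTop.1
    (h.tendsto_y_atTop.eventually (lt_mem_nhds (show (5 / 4 : ℝ) < 2 by norm_num)))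
  set R := max (S + 1) S' with hR
  have hSR : S < R := (by linarith : S < S + 1).trans_le (le_max_left _ _)
  -- The slope `m = (2-y)/(2-x)` satisfies the Riccati equation `m' = -y + m - m² = -y + 1/4 - (m -
  -- 1/2)²`. Once `y ≥ 5/4` this is at most `-1`, so `m` loses its positivity within time `m(R)`.
  have hd : ∀ s, R ≤ s → HasDerivAt (fun s => (2 - y s) / (2 - x s) + s)
      (-y s - ((2 - y s) / (2 - x s)) ^ 2 + (2 - y s) / (2 - x s) + 1) s := by
    intro s hs
    have hne : 2 - x s ≠ 0 := fun h0 => by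
      have := hS s (hSR.trans_le hs)
      rw [h0, div_zero] at this
      exact lt_irrefl _ this
    have h1 := (((h.deriv_y s).const_sub 2).div ((h.deriv_x s).const_sub 2) hne).add
      (hasDerivAt_id s)
    refine h1.congr_deriv ?_
    field_simp
    ring
  have hanti : AntitoneOn (fun s => (2 - y s) / (2 - x s) + s) (Ici R) := by
    apply antitoneOn_of_deriv_nonpos (convex_Ici R)
      (fun s hs => (hd s hs).continuousAt.continuousWithinAt)
    · intro s hs
      rw [interior_Ici] at hs
      exact (hd s (le_of_lt hs)).differentiableAt.differentiableWithinAt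
    · intro s hs
      rw [interior_Ici] at hs
      rw [(hd s (le_of_lt hs)).deriv]
      have := hS' s ((le_max_right _ _).trans (le_of_lt hs))
      nlinarith [sq_nonneg ((2 - y s) / (2 - x s) - 1 / 2)]
  set m := (2 - y R) / (2 - x R) with hm
  have hm0 : 0 < m := hS R hSR
  have h1 := hanti self_mem_Ici (show R ≤ R + m by linarith) (by linarith : R ≤ R + m)
  have h2 := hS (R + m) (by linarith)
  simp only at h1
  linarith

/-- After a last critical point `x` would be monotone, hence on one side of its limit `2`. Then `y'
= (2-x)y` has a sign too, which puts `y` on the same side, and the orbit would remain in one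
quadrant around `(2,2)`. -/
theorem not_bddAbove_critical (h : IsHeteroclinic x y) : ¬BddAbove {s | y s - x s = 0} := by
  rintro ⟨S, hS⟩
  have hne : ∀ s ∈ Ioi S, y s - x s ≠ 0 := fun s hs h0 => absurd (hS h0) (not_le.2 hs)
  have hc : Continuous fun s => y s - x s := h.continuous_y.sub h.continuous_x
  have hmem : S + 1 ∈ Ioi S := show S < S + 1 by linarith
  rcases lt_or_gt_of_ne (hne _ hmem) with h1 | h1
  · have hpos := pos_of_ordConnected_of_ne_zero ordConnected_Ioi hc.neg (fun s hs => neg_ne_zero.2 (hne s hs)) hmem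
      (neg_pos.2 h1)
    have hx : ∀ s, S < s → 2 < x s := fun s hs => by
      have := lt_of_tendsto_of_deriv_pos (fun s => (h.deriv_x s).neg) hpos h.tendsto_x_atTop.neg hs
      exact neg_lt_neg_iff.1 this
    have hy : ∀ s, S < s → 2 < y s := fun s hs => by
      have := lt_of_tendsto_of_deriv_pos (fun s => (h.deriv_y s).neg)
        (fun s hs => by nlinarith [hx s hs, h.y_pos s]) h.tendsto_y_atTop.neg hs
      exact neg_lt_neg_iff.1 this
    exact h.not_eventually_same_sign (S := S) fun s hs =>
      div_pos_of_neg_of_neg (by linarith [hy s hs]) (by linarith [hx s hs])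
  · have hpos := pos_of_ordConnected_of_ne_zero ordConnected_Ioi hc hne hmem h1
    have hx : ∀ s, S < s → x s < 2 := fun s hs =>
      lt_of_tendsto_of_deriv_pos h.deriv_x hpos h.tendsto_x_atTop hs
    have hy : ∀ s, S < s → y s < 2 := fun s hs =>
      lt_of_tendsto_of_deriv_pos h.deriv_y
        (fun s hs => mul_pos (by linarith [hx s hs]) (h.y_pos s)) h.tendsto_y_atTop hs
    exact h.not_eventually_same_sign (S := S) fun s hs =>
      div_pos (by linarith [hy s hs]) (by linarith [hx s hs])

/-- The critical points of the mass along the spiral form a sequence in which local maxima and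
local minima alternate. -/
theorem exists_critical_sequence (h : IsHeteroclinic x y) :
    ∃ z : ℕ → ℝ, StrictMono z ∧ range z = {s | y s - x s = 0} ∧
      (∀ k, 2 < x (z (2 * k))) ∧ ∀ k, x (z (2 * k + 1)) < 2 := by
  have hc : Continuous fun s => y s - x s := h.continuous_y.sub h.continuous_x
  obtain ⟨s₀, hs₀⟩ := h.exists_speed_pos
  obtain ⟨z, hz, hzr⟩ := exists_enumeration_of_locally_finite
    (finite_zeros_inter_Icc h.hasDerivAt_speed fun s hs => h.deriv_speed_ne_zero hs)
    ⟨s₀, fun s hs => le_of_not_gt fun hlt => (hs₀ s hlt.le).ne' hs⟩ h.not_bddAbove_critical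
  have hz0 : ∀ k, y (z k) - x (z k) = 0 := fun k => by
    have : z k ∈ range z := mem_range_self k
    rwa [hzr] at this
  have hmem : ∀ s, y s - x s = 0 → ∃ k, z k = s := fun s hs => by
    have : s ∈ range z := by rw [hzr]; exact hs
    exact this
  have hsign : ∀ {k : ℕ} {r : ℝ}, r = (2 - x (z k)) * y (z k) - (y (z k) - x (z k)) →
      (r < 0 ↔ 2 < x (z k)) ∧ (0 < r ↔ x (z k) < 2) := by
    rintro k r rfl
    have := h.y_pos (z k)
    rw [hz0 k, sub_zero, mul_pos_iff_of_pos_right this, mul_neg_iff]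
    refine ⟨⟨fun h1 => ?_, fun h1 => Or.inr ⟨by linarith, this⟩⟩,
      fun h1 => by linarith, fun h1 => by linarith⟩
    rcases h1 with h1 | h1 <;> linarith [h1.1, h1.2]
  have hstep : ∀ k, (2 < x (z k) → x (z (k + 1)) < 2) ∧ (x (z k) < 2 → 2 < x (z (k + 1))) := by
    intro k
    have h1 := deriv_mul_neg_of_consecutive_zeros hc (hz (Nat.lt_succ_self k))
      (h.hasDerivAt_speed (z k)) (h.hasDerivAt_speed (z (k + 1))) (hz0 k) (hz0 (k + 1))
      (h.deriv_speed_ne_zero (hz0 k)) (h.deriv_speed_ne_zero (hz0 (k + 1))) (fun s hs h0 => by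
        obtain ⟨j, rfl⟩ := hmem s h0
        have h1 := hz.lt_iff_lt.1 hs.1
        have h2 := hz.lt_iff_lt.1 hs.2
        omega)
    have h2 := hsign (k := k) rfl
    have h3 := hsign (k := k + 1) rfl
    constructor
    · intro h4
      rw [← h2.1] at h4
      rw [← h3.2]
      exact pos_of_mul_neg_right h1 h4.le
    · intro h4
      rw [← h2.2] at h4
      rw [← h3.1]
      exact neg_of_mul_neg_right h1 h4.le
  -- The speed is positive near `-∞` and has no zero before `z 0`, so it cannot be negative just to
  -- the left of `z 0`: the first critical point is a maximum.
  have hfirst : 2 < x (z 0) := by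
    rw [← (hsign (k := 0) rfl).1]
    refine lt_of_le_of_ne (le_of_not_gt fun hpos => ?_) (h.deriv_speed_ne_zero (hz0 0))
    obtain ⟨t, ht, htz⟩ := ((eventually_pos_right_and_neg_left (h.hasDerivAt_speed (z 0)) (hz0 0)
      hpos).2.and self_mem_nhdsWithin).exists
    have h1 : min s₀ (t - 1) < z 0 := by linarith [min_le_right s₀ (t - 1)]
    have h2 := pos_of_ordConnected_of_ne_zero ordConnected_Iio hc (fun s hs h0 => by
      obtain ⟨j, rfl⟩ := hmem s h0
      exact Nat.not_lt_zero _ (hz.lt_iff_lt.1 hs)) h1 (hs₀ _ (min_le_left _ _)) t htz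
    exact lt_asymm ht h2
  have heven : ∀ k, 2 < x (z (2 * k)) := by
    intro k
    induction k with
    | zero => exact hfirst
    | succ k ih => exact (hstep (2 * k + 1)).2 ((hstep (2 * k)).1 ih)
  exact ⟨z, hz, hzr, heven, fun k => (hstep (2 * k)).1 (heven k)⟩

end IsHeteroclinic

/-! ### Ordering of the turning masses by their energy. -/

theorem hasDerivAt_energy_diag {t : ℝ} (ht : 0 < t) :
    HasDerivAt (fun t => energy t t) ((t - 2) * (1 + 1 / t)) t := by
  have h1 := ((((hasDerivAt_id t).sub_const 2).pow 2).div_const 2).add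
    (((hasDerivAt_id t).sub_const 2).sub ((((hasDerivAt_id t).div_const 2).log
      (by simp only [id]; positivity)).const_mul 2))
  refine h1.congr_deriv ?_
  simp only [id]
  field_simp
  ring

theorem monotoneOn_energy_diag : MonotoneOn (fun t => energy t t) (Ici 2) := by
  have hpos : ∀ {t : ℝ}, 2 ≤ t → 0 < t := fun h => by linarith
  apply monotoneOn_of_deriv_nonneg (convex_Ici 2)
    (fun t ht => (hasDerivAt_energy_diag (hpos ht)).continuousAt.continuousWithinAt)
  · intro t ht
    rw [interior_Ici] at ht
    exact (hasDerivAt_energy_diag (hpos (le_of_lt ht))).differentiableAt.differentiableWithinAt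
  · intro t ht
    rw [interior_Ici, mem_Ioi] at ht
    have := hpos ht.le
    rw [(hasDerivAt_energy_diag this).deriv]
    exact mul_nonneg (by linarith) (by positivity)

theorem antitoneOn_energy_diag : AntitoneOn (fun t => energy t t) (Ioc 0 2) := by
  apply antitoneOn_of_deriv_nonpos (convex_Ioc 0 2)
    (fun t ht => (hasDerivAt_energy_diag ht.1).continuousAt.continuousWithinAt)
  · intro t ht
    rw [interior_Ioc] at ht
    exact (hasDerivAt_energy_diag ht.1).differentiableAt.differentiableWithinAt
  · intro t ht
    rw [interior_Ioc] at ht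
    have := ht.1
    rw [(hasDerivAt_energy_diag this).deriv]
    exact mul_nonpos_of_nonpos_of_nonneg (by linarith [ht.2]) (by positivity)

namespace IsHeteroclinic

variable {x y : ℝ → ℝ}

/-- Translations of `s` preserve local minima and their values, and any two parametrizations differ
by a translation, so one orbit carries all the values. -/
theorem lowerTurningMasses_eq (h : IsHeteroclinic x y) :
    lowerTurningMasses = {m | ∃ s, IsLocalMin x s ∧ m = 4 * Real.pi * x s} := by
  ext m
  constructor
  · rintro ⟨x', y', h', s, hs, rfl⟩
    obtain ⟨a, ha⟩ := h.exists_tendsto_log_sub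
    obtain ⟨a', ha'⟩ := h'.exists_tendsto_log_sub
    have heq := h'.eq_translate h ha' ha
    have heq' := h.eq_translate h' ha ha'
    refine ⟨s + (a' - a) / 2, ?_, by rw [heq]⟩
    have hc : Tendsto (fun t => t + (a - a') / 2) (𝓝 (s + (a' - a) / 2)) (𝓝 s) := by
      have : Continuous fun t : ℝ => t + (a - a') / 2 := by fun_prop
      simpa [show s + (a' - a) / 2 + (a - a') / 2 = s by ring] using this.tendsto (s + (a' - a) / 2)
    filter_upwards [hc.eventually hs] with t ht
    rw [← heq s, heq' t]
    exact ht
  · rintro ⟨s, hs, rfl⟩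
    exact ⟨x, y, h, s, hs, rfl⟩

theorem upperTurningMasses_eq (h : IsHeteroclinic x y) :
    upperTurningMasses = {m | ∃ s, IsLocalMax x s ∧ m = 4 * Real.pi * x s} := by
  ext m
  constructor
  · rintro ⟨x', y', h', s, hs, rfl⟩
    obtain ⟨a, ha⟩ := h.exists_tendsto_log_sub
    obtain ⟨a', ha'⟩ := h'.exists_tendsto_log_sub
    have heq := h'.eq_translate h ha' ha
    have heq' := h.eq_translate h' ha ha'
    refine ⟨s + (a' - a) / 2, ?_, by rw [heq]⟩
    have hc : Tendsto (fun t => t + (a - a') / 2) (𝓝 (s + (a' - a) / 2)) (𝓝 s) := by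
      have : Continuous fun t : ℝ => t + (a - a') / 2 := by fun_prop
      simpa [show s + (a' - a) / 2 + (a - a') / 2 = s by ring] using this.tendsto (s + (a' - a) / 2)
    filter_upwards [hc.eventually hs] with t ht
    rw [← heq s, heq' t]
    exact ht
  · rintro ⟨s, hs, rfl⟩
    exact ⟨x, y, h, s, hs, rfl⟩

/-- The turning masses are the masses at the critical points of the spiral, upper and lower
ones alternating. -/
theorem exists_areTurningMasses (h : IsHeteroclinic x y) :
    ∃ z : ℕ → ℝ, StrictMono z ∧ AreTurningMasses
      (fun n : ℕ+ => 4 * Real.pi * x (z (2 * n.natPred + 1)))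
      (fun n : ℕ+ => 4 * Real.pi * x (z (2 * n.natPred))) := by
  obtain ⟨z, hz, hzr, hup, hlo⟩ := h.exists_critical_sequence
  have hπ : 0 < 4 * Real.pi := by positivity
  have hz0 : ∀ k, y (z k) = x (z k) := fun k => by
    have : z k ∈ range z := mem_range_self k
    rw [hzr] at this
    exact sub_eq_zero.1 this
  -- At critical points `y = x`, so the decrease of the energy is a statement about its diagonal
  -- values. Monotonicity of these on either side of `2` then orders the extrema.
  have hE : ∀ {i j : ℕ}, i < j → energy (x (z j)) (x (z j)) < energy (x (z i)) (x (z i)) := by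
    intro i j hij
    have := h.strictAnti_energy (hz hij)
    simpa only [hz0] using this
  have hpred : ∀ {m n : ℕ+}, m < n → m.natPred < n.natPred := fun hmn =>
    PNat.natPred_lt_natPred.2 hmn
  have hmem : ∀ s, y s - x s = 0 → ∃ k, z k = s := fun s hs => by
    have : s ∈ range z := by rw [hzr]; exact hs
    exact this
  refine ⟨z, hz, fun m n hmn => ?_, ?_, fun m n hmn => ?_, ?_, fun m n => ?_⟩
  · refine mul_lt_mul_of_pos_left (lt_of_not_ge fun hge => ?_) hπ
    have h1 := hE (show 2 * m.natPred + 1 < 2 * n.natPred + 1 by have := hpred hmn; omega)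
    exact absurd h1 (not_lt.2 (antitoneOn_energy_diag ⟨h.x_pos _, (hlo _).le⟩
      ⟨h.x_pos _, (hlo _).le⟩ hge))
  · rw [h.lowerTurningMasses_eq]
    ext w
    constructor
    · rintro ⟨n, rfl⟩
      exact ⟨_, (h.isLocalMin_iff _).2 ⟨sub_eq_zero.2 (hz0 _), hlo _⟩, rfl⟩
    · rintro ⟨s, hs, rfl⟩
      rw [h.isLocalMin_iff] at hs
      obtain ⟨k, rfl⟩ := hmem s hs.1
      obtain ⟨j, rfl | rfl⟩ := Nat.even_or_odd' k
      · exact absurd hs.2 (not_lt.2 (hup j).le)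
      · exact ⟨j.succPNat, by simp⟩
  · refine mul_lt_mul_of_pos_left (lt_of_not_ge fun hge => ?_) hπ
    have h1 := hE (show 2 * m.natPred < 2 * n.natPred by have := hpred hmn; omega)
    exact absurd h1 (not_lt.2 (monotoneOn_energy_diag (hup _).le (hup _).le hge))
  · rw [h.upperTurningMasses_eq]
    ext w
    constructor
    · rintro ⟨n, rfl⟩
      exact ⟨_, (h.isLocalMax_iff _).2 ⟨sub_eq_zero.2 (hz0 _), hup _⟩, rfl⟩
    · rintro ⟨s, hs, rfl⟩
      rw [h.isLocalMax_iff] at hs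
      obtain ⟨k, rfl⟩ := hmem s hs.1
      obtain ⟨j, rfl | rfl⟩ := Nat.even_or_odd' k
      · exact ⟨j.succPNat, by simp⟩
      · exact absurd hs.2 (not_lt.2 (hlo j).le)
  · exact mul_lt_mul_of_pos_left ((hlo _).trans (hup _)) hπ

end IsHeteroclinic

/-! ### The simplified Fermi–Dirac nonlinearity -/

theorem hasDerivAt_simplifiedH (η : ℝ) {ρ : ℝ} (hρ : 0 < ρ) :
    HasDerivAt (simplifiedH η) (ρ⁻¹ + η * ρ ^ (-(1 / 3) : ℝ)) ρ := by
  have h1 := (Real.hasDerivAt_log hρ.ne').add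
    ((Real.hasDerivAt_rpow_const (p := 2 / 3) (Or.inl hρ.ne')).const_mul (3 / 2 * η))
  refine h1.congr_deriv ?_
  rw [show (2 / 3 - 1 : ℝ) = -(1 / 3) by norm_num]
  ring

theorem simplifiedF_monotone {η : ℝ} (hη : 0 < η) : Monotone (simplifiedF η) := by
  intro z w hzw
  have hz := simplifiedF_spec hη z
  have hw := simplifiedF_spec hη w
  rw [← hz.2, ← hw.2] at hzw
  exact (simplifiedH_strictMonoOn hη).le_iff_le hz.1 hw.1 |>.1 hzw

theorem continuous_simplifiedF {η : ℝ} (hη : 0 < η) : Continuous (simplifiedF η) := by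
  -- Both terms of `H` increase with `ρ` and their increments add up to `w - z`; hence `log F` is
  -- `1`-Lipschitz.
  have hle : ∀ z w, z ≤ w → |Real.log (simplifiedF η w) - Real.log (simplifiedF η z)| ≤ w - z := by
    intro z w hzw
    have hz := simplifiedF_spec hη z
    have hw := simplifiedF_spec hη w
    have h1 := simplifiedF_monotone hη hzw
    have h2 : simplifiedF η z ^ (2 / 3 : ℝ) ≤ simplifiedF η w ^ (2 / 3 : ℝ) :=
      Real.rpow_le_rpow hz.1.le h1 (by norm_num)
    have h3 := mul_le_mul_of_nonneg_left h2 (show 0 ≤ 3 / 2 * η by positivity)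
    have h4 := Real.log_le_log hz.1 h1
    have h5 := hz.2
    have h6 := hw.2
    unfold simplifiedH at h5 h6
    rw [abs_of_nonneg (by linarith)]
    linarith
  have hlip : LipschitzWith 1 fun z => Real.log (simplifiedF η z) := by
    refine LipschitzWith.of_dist_le_mul fun z w => ?_
    rw [NNReal.coe_one, one_mul, Real.dist_eq, Real.dist_eq]
    rcases le_total z w with h | h
    · rw [abs_sub_comm, abs_sub_comm z w, abs_of_nonneg (sub_nonneg.2 h)]
      exact hle z w h
    · rw [abs_of_nonneg (sub_nonneg.2 h)]
      exact hle w z h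
  exact (Real.continuous_exp.comp hlip.continuous).congr fun z =>
    Real.exp_log (simplifiedF_spec hη z).1

theorem hasDerivAt_simplifiedF {η : ℝ} (hη : 0 < η) (z : ℝ) :
    HasDerivAt (simplifiedF η)
      ((simplifiedF η z)⁻¹ + η * simplifiedF η z ^ (-(1 / 3) : ℝ))⁻¹ z := by
  have hpos := (simplifiedF_spec hη z).1
  exact (hasDerivAt_simplifiedH η hpos).of_local_left_inverse
    (continuous_simplifiedF hη).continuousAt (by positivity)
    (Eventually.of_forall fun w => (simplifiedF_spec hη w).2)

theorem admissible_simplifiedF {η : ℝ} (hη : 0 < η) : Admissible (simplifiedF η) := by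
  have hpos := fun z => (simplifiedF_spec hη z).1
  have hd : deriv (simplifiedF η) = fun z =>
      ((simplifiedF η z)⁻¹ + η * simplifiedF η z ^ (-(1 / 3) : ℝ))⁻¹ :=
    funext fun z => (hasDerivAt_simplifiedF hη z).deriv
  refine ⟨contDiff_one_iff_deriv.2 ⟨fun z => (hasDerivAt_simplifiedF hη z).differentiableAt, ?_⟩,
    hpos, fun z => ?_, fun z => ?_⟩
  · rw [hd]
    have hc := continuous_simplifiedF hη
    refine Continuous.inv₀ ((hc.inv₀ fun z => (hpos z).ne').add (continuous_const.mul
      (hc.rpow_const fun z => Or.inl (hpos z).ne'))) fun z => ?_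
    have := hpos z
    positivity
  · have := hpos z
    rw [hd]
    positivity
  · have := hpos z
    rw [hd]
    refine inv_le_of_inv_le₀ this ?_
    have : 0 ≤ η * simplifiedF η z ^ (-(1 / 3) : ℝ) := by positivity
    linarith

/-- The equation for `ρ` reads `ρ = e^z e^{-r}` with `r = (3/2) η ρ^{2/3} ≥ 0`. Hence `ρ ≤ e^z`, and
the defect is at most `e^z r`, of order `η` below `A`; no translation is needed. -/
theorem abs_exp_sub_simplifiedF_le {η : ℝ} (hη : 0 < η) {A z : ℝ} (hz : z ≤ A) :
    |Real.exp z - simplifiedF η z| ≤ Real.exp A * (3 / 2 * η * Real.exp A ^ (2 / 3 : ℝ)) := by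
  obtain ⟨hpos, hspec⟩ := simplifiedF_spec hη z
  unfold simplifiedH at hspec
  set ρ := simplifiedF η z
  set r := 3 / 2 * η * ρ ^ (2 / 3 : ℝ) with hr
  have hr0 : 0 ≤ r := by positivity
  have hρ : ρ = Real.exp z * Real.exp (-r) := by
    rw [← Real.exp_add, ← hspec, add_neg_cancel_right, Real.exp_log hpos]
  have hle : ρ ≤ Real.exp z := by
    rw [hρ]
    exact mul_le_of_le_one_right (Real.exp_pos z).le (Real.exp_le_one_iff.2 (by linarith))
  have hzA := Real.exp_le_exp.2 hz
  rw [abs_of_nonneg (by linarith)]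
  calc Real.exp z - ρ = Real.exp z * (1 - Real.exp (-r)) := by rw [hρ]; ring
    _ ≤ Real.exp z * r := by
      gcongr
      linarith [Real.add_one_le_exp (-r)]
    _ ≤ _ := by
      rw [hr]
      have h1 : ρ ^ (2 / 3 : ℝ) ≤ Real.exp A ^ (2 / 3 : ℝ) :=
        Real.rpow_le_rpow hpos.le (hle.trans hzA) (by norm_num)
      gcongr

/-! ### The Fermi–Dirac nonlinearity -/

theorem integrableOn_rpow_mul_exp_neg :
    IntegrableOn (fun t : ℝ => t ^ (1 / 2 : ℝ) * Real.exp (-t)) (Ioi 0) := by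
  have := Real.GammaIntegral_convergent (s := 3 / 2) (by norm_num)
  refine this.congr_fun (fun t _ => ?_) measurableSet_Ioi
  simp only
  rw [show (3 / 2 - 1 : ℝ) = 1 / 2 by norm_num, mul_comm]

theorem fermi_integrand_le (t z : ℝ) : 1 / (1 + Real.exp (t - z)) ≤ Real.exp z * Real.exp (-t) := by
  rw [← Real.exp_add, div_le_iff₀ (by positivity), mul_add, ← Real.exp_add]
  have : z + -t + (t - z) = 0 := by ring
  rw [this, Real.exp_zero]
  linarith [Real.exp_pos (z + -t)]

theorem measurable_fermi_integrand (z : ℝ) :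
    Measurable fun t : ℝ => t ^ (1 / 2 : ℝ) / (1 + Real.exp (t - z)) := by fun_prop

theorem integrableOn_fermi_integrand (z : ℝ) :
    IntegrableOn (fun t : ℝ => t ^ (1 / 2 : ℝ) / (1 + Real.exp (t - z))) (Ioi 0) := by
  refine (integrableOn_rpow_mul_exp_neg.const_mul (Real.exp z)).mono'
    (measurable_fermi_integrand z).aestronglyMeasurable ?_
  filter_upwards [ae_restrict_mem measurableSet_Ioi] with t ht
  have ht0 : (0 : ℝ) < t := ht
  rw [Real.norm_of_nonneg (by positivity), div_eq_mul_one_div]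
  calc _ ≤ t ^ (1 / 2 : ℝ) * (Real.exp z * Real.exp (-t)) := by
        gcongr; exact fermi_integrand_le t z
    _ = _ := by ring

/-- The derivative of the Fermi integrand of order `1/2` with respect to the parameter. -/
noncomputable def fermiKernel (z t : ℝ) : ℝ :=
  t ^ (1 / 2 : ℝ) * (Real.exp (t - z) / (1 + Real.exp (t - z)) ^ 2)

theorem measurable_fermiKernel (z : ℝ) : Measurable (fermiKernel z) := by
  unfold fermiKernel
  fun_prop

theorem fermiKernel_pos (z : ℝ) {t : ℝ} (ht : 0 < t) : 0 < fermiKernel z t := by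
  unfold fermiKernel
  positivity

/-- The kernel is the integrand times `e^{t-z}/(1+e^{t-z}) ≤ 1`. Integrated, this becomes `G' ≤ G`.
-/
theorem fermiKernel_le (z : ℝ) {t : ℝ} (ht : 0 < t) :
    fermiKernel z t ≤ t ^ (1 / 2 : ℝ) / (1 + Real.exp (t - z)) := by
  unfold fermiKernel
  rw [div_eq_mul_one_div (t ^ (1 / 2 : ℝ))]
  refine mul_le_mul_of_nonneg_left ?_ (by positivity)
  rw [div_le_div_iff₀ (by positivity) (by positivity)]
  nlinarith [Real.exp_pos (t - z)]

theorem fermiKernel_le_of_le {z w t : ℝ} (hzw : z ≤ w) (ht : 0 < t) :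
    ‖fermiKernel z t‖ ≤ Real.exp w * (t ^ (1 / 2 : ℝ) * Real.exp (-t)) := by
  rw [Real.norm_of_nonneg (fermiKernel_pos z ht).le]
  refine (fermiKernel_le z ht).trans ?_
  rw [div_eq_mul_one_div]
  calc _ ≤ t ^ (1 / 2 : ℝ) * (Real.exp z * Real.exp (-t)) := by
        gcongr; exact fermi_integrand_le t z
    _ ≤ t ^ (1 / 2 : ℝ) * (Real.exp w * Real.exp (-t)) := by gcongr
    _ = _ := by ring

theorem hasDerivAt_fermi (z : ℝ) :
    HasDerivAt (fermi (1 / 2)) (∫ t in Ioi (0 : ℝ), fermiKernel z t) z := by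
  refine (hasDerivAt_integral_of_dominated_loc_of_deriv_le
    (F := fun z t => t ^ (1 / 2 : ℝ) / (1 + Real.exp (t - z))) (F' := fermiKernel)
    (bound := fun t => Real.exp (z + 1) * (t ^ (1 / 2 : ℝ) * Real.exp (-t)))
    (Iic_mem_nhds (show z < z + 1 by linarith))
    (Eventually.of_forall fun w => (measurable_fermi_integrand w).aestronglyMeasurable)
    (integrableOn_fermi_integrand z) (measurable_fermiKernel z).aestronglyMeasurable ?_
    (integrableOn_rpow_mul_exp_neg.const_mul _) ?_).2
  · filter_upwards [ae_restrict_mem measurableSet_Ioi] with t ht w hw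
    exact fermiKernel_le_of_le hw ht
  · refine Eventually.of_forall fun t w _ => ?_
    have h1 := ((((hasDerivAt_id w).const_sub t).exp.const_add 1).inv
      (by simp only [id]; positivity)).const_mul (t ^ (1 / 2 : ℝ))
    refine h1.congr_deriv ?_
    simp only [id, fermiKernel]
    ring

theorem admissible_fermi : Admissible (fermi (1 / 2)) := by
  have hd : deriv (fermi (1 / 2)) = fun z => ∫ t in Ioi (0 : ℝ), fermiKernel z t :=
    funext fun z => (hasDerivAt_fermi z).deriv
  have hint : ∀ z, IntegrableOn (fermiKernel z) (Ioi 0) := fun z =>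
    (integrableOn_rpow_mul_exp_neg.const_mul (Real.exp z)).mono'
      (measurable_fermiKernel z).aestronglyMeasurable (by
        filter_upwards [ae_restrict_mem measurableSet_Ioi] with t ht
        exact fermiKernel_le_of_le le_rfl ht)
  have hle : ∀ z, deriv (fermi (1 / 2)) z ≤ fermi (1 / 2) z := fun z => by
    rw [hd]
    exact setIntegral_mono_on (hint z) (integrableOn_fermi_integrand z) measurableSet_Ioi
      fun t ht => fermiKernel_le z ht
  have hpos : ∀ z, 0 < deriv (fermi (1 / 2)) z := fun z => by
    rw [hd]
    have h0 : 0 ≤ᵐ[volume.restrict (Ioi (0 : ℝ))] fermiKernel z := by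
      filter_upwards [ae_restrict_mem measurableSet_Ioi] with t ht
      exact (fermiKernel_pos z ht).le
    simp only
    rw [setIntegral_pos_iff_support_of_nonneg_ae h0 (hint z)]
    have : Function.support (fermiKernel z) ∩ Ioi 0 = Ioi 0 :=
      inter_eq_right.2 fun t ht => (fermiKernel_pos z ht).ne'
    rw [this]
    simp
  refine ⟨contDiff_one_iff_deriv.2 ⟨fun z => (hasDerivAt_fermi z).differentiableAt, ?_⟩,
    fun z => (hpos z).trans_le (hle z), hpos, hle⟩
  rw [hd, continuous_iff_continuousAt]
  intro z
  refine continuousAt_of_dominated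
    (bound := fun t => Real.exp (z + 1) * (t ^ (1 / 2 : ℝ) * Real.exp (-t)))
    (Eventually.of_forall fun w => (measurable_fermiKernel w).aestronglyMeasurable) ?_
    (integrableOn_rpow_mul_exp_neg.const_mul _) (Eventually.of_forall fun t => ?_)
  · filter_upwards [Iic_mem_nhds (show z < z + 1 by linarith)] with w hw
    filter_upwards [ae_restrict_mem measurableSet_Ioi] with t ht
    exact fermiKernel_le_of_le hw ht
  · unfold fermiKernel
    have : Continuous fun w => t ^ (1 / 2 : ℝ) * (Real.exp (t - w) / (1 + Real.exp (t - w)) ^ 2) :=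
      continuous_const.mul (Continuous.div (by fun_prop) (by fun_prop) fun w => by positivity)
    exact this.continuousAt

theorem Admissible.const_mul {G : ℝ → ℝ} (h : Admissible G) {k : ℝ} (hk : 0 < k) :
    Admissible fun z => k * G z := by
  have hd : deriv (fun z => k * G z) = fun z => k * deriv G z :=
    funext fun z => ((h.hasDerivAt z).const_mul k).deriv
  refine ⟨contDiff_const.mul h.contDiff, fun z => mul_pos hk (h.pos z), fun z => ?_, fun z => ?_⟩
  · rw [hd]
    exact mul_pos hk (h.deriv_pos z)
  · rw [hd]
    exact mul_le_mul_of_nonneg_left (h.deriv_le z) hk.le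

theorem Admissible.comp_sub_const {G : ℝ → ℝ} (h : Admissible G) (c : ℝ) :
    Admissible fun z => G (z - c) := by
  have hd : deriv (fun z => G (z - c)) = fun z => deriv G (z - c) :=
    funext fun z => ((h.hasDerivAt (z - c)).comp_sub_const z c).deriv
  refine ⟨h.contDiff.comp (contDiff_id.sub contDiff_const), fun z => h.pos _, fun z => ?_,
    fun z => ?_⟩
  · rw [hd]
    exact h.deriv_pos _
  · rw [hd]
    exact h.deriv_le _

/-- With `u = e^{w-t}`, the integrand differs from its Boltzmann approximation by the factor `u -
1/(1+1/u) = u²/(1+u) ≤ u²`, and `u² ≤ e^{-t} e^{2w}` for `t > 0`. -/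
theorem abs_fermi_sub_le (w : ℝ) :
    |(∫ t in Ioi (0 : ℝ), t ^ (1 / 2 : ℝ) * Real.exp (-t)) * Real.exp w - fermi (1 / 2) w| ≤
      (∫ t in Ioi (0 : ℝ), t ^ (1 / 2 : ℝ) * Real.exp (-t)) * Real.exp (2 * w) := by
  have hI := integrableOn_rpow_mul_exp_neg
  rw [fermi, ← integral_mul_const, ← integral_mul_const,
    ← integral_sub (hI.mul_const _) (integrableOn_fermi_integrand w), ← Real.norm_eq_abs]
  refine norm_integral_le_of_norm_le (hI.mul_const _) ?_
  filter_upwards [ae_restrict_mem measurableSet_Ioi] with t ht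
  have ht0 : (0 : ℝ) < t := ht
  have hr : (0 : ℝ) ≤ t ^ (1 / 2 : ℝ) := by positivity
  have h1 := fermi_integrand_le t w
  have h2 : Real.exp w * Real.exp (-t) - 1 / (1 + Real.exp (t - w)) ≤
      Real.exp (-t) * Real.exp (2 * w) := by
    set u := Real.exp (w - t) with hu
    have hu0 : 0 < u := Real.exp_pos _
    have e1 : Real.exp w * Real.exp (-t) = u := by rw [← Real.exp_add, hu, sub_eq_add_neg]
    have e2 : Real.exp (t - w) = u⁻¹ := by rw [hu, ← Real.exp_neg, neg_sub]
    have e3 : u ^ 2 ≤ Real.exp (-t) * Real.exp (2 * w) := by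
      rw [hu, ← Real.exp_nat_mul, ← Real.exp_add, Real.exp_le_exp]
      push_cast
      linarith
    have e4 : u - 1 / (1 + u⁻¹) = u ^ 2 / (1 + u) := by
      field_simp
      ring
    rw [e1, e2, e4]
    refine le_trans ?_ e3
    exact div_le_self (sq_nonneg u) (by linarith)
  have e : t ^ (1 / 2 : ℝ) * Real.exp (-t) * Real.exp w - t ^ (1 / 2 : ℝ) / (1 + Real.exp (t - w))
      = t ^ (1 / 2 : ℝ) * (Real.exp w * Real.exp (-t) - 1 / (1 + Real.exp (t - w))) := by ring
  rw [e, Real.norm_of_nonneg (mul_nonneg hr (by linarith)), mul_assoc]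
  gcongr

theorem exists_forall_le_muOf (K : ℝ) : ∃ η₀, 0 < η₀ ∧ ∀ η, 0 < η → η < η₀ → K ≤ muOf η := by
  -- For `η < 1` one has `η³ ≤ η`, so the second bound gives `K² η³ ≤ 8/3`; the `+ 1` avoids
  -- division by zero.
  refine ⟨min 1 (8 / 3 / (K ^ 2 + 1)), by positivity, fun η hη hlt => ?_⟩
  have h1 := hlt.trans_le (min_le_left _ _)
  have h2 := hlt.trans_le (min_le_right _ _)
  rw [lt_div_iff₀ (by positivity)] at h2
  unfold muOf
  apply Real.le_sqrt_of_sq_le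
  rw [le_div_iff₀ (by positivity)]
  have h3 : η ^ 3 ≤ η := by
    calc η ^ 3 ≤ η ^ 1 := pow_le_pow_of_le_one hη.le h1.le (by norm_num)
      _ = η := pow_one η
  nlinarith [mul_le_mul_of_nonneg_left h3 (sq_nonneg K)]

/-! ### The limit `η → 0` and the conclusion. -/

/-- A family `F η` that is admissible and, after a translation of the variable, converges to the
exponential function as `η → 0`. -/
def ConvergesToExp (F : ℝ → ℝ → ℝ) : Prop :=
  ∀ A ε : ℝ, 0 < ε → ∃ η₀, 0 < η₀ ∧ ∀ η, 0 < η → η < η₀ →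
    ∃ c, Admissible (fun z => F η (z - c)) ∧ ∀ z ≤ A, |Real.exp z - F η (z - c)| ≤ ε

theorem convergesToExp_simplifiedF : ConvergesToExp simplifiedF := by
  intro A ε hε
  set K := Real.exp A * (3 / 2 * Real.exp A ^ (2 / 3 : ℝ)) with hK
  have hK0 : 0 < K := by positivity
  refine ⟨ε / K, by positivity, fun η hη hlt => ⟨0, ?_, fun z hz => ?_⟩⟩
  · simpa using admissible_simplifiedF hη
  · rw [lt_div_iff₀ hK0] at hlt
    rw [sub_zero]
    refine (abs_exp_sub_simplifiedF_le hη hz).trans (le_trans (le_of_eq ?_) hlt.le)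
    rw [hK]
    ring

theorem convergesToExp_fermiDiracF : ConvergesToExp fermiDiracF := by
  intro A ε hε
  set g := ∫ t in Ioi (0 : ℝ), t ^ (1 / 2 : ℝ) * Real.exp (-t) with hg
  have hg0 : 0 < g := by
    rw [hg, setIntegral_pos_iff_support_of_nonneg_ae ?_ integrableOn_rpow_mul_exp_neg]
    · have : Function.support (fun t : ℝ => t ^ (1 / 2 : ℝ) * Real.exp (-t)) ∩ Ioi 0 = Ioi 0 :=
        inter_eq_right.2 fun t (ht : 0 < t) => by
          rw [Function.mem_support]
          positivity
      rw [this]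
      simp
    · filter_upwards [ae_restrict_mem measurableSet_Ioi] with t ht
      have ht0 : (0 : ℝ) < t := ht
      simp only [Pi.zero_apply]
      positivity
  obtain ⟨η₀, hη₀, hμ⟩ := exists_forall_le_muOf (2 * Real.exp (2 * A) / (g * ε))
  refine ⟨η₀, hη₀, fun η hη hlt => ?_⟩
  have hμ0 := (muOf_spec hη).1
  have hμK := hμ η hη hlt
  rw [div_le_iff₀ (by positivity)] at hμK
  set μ := muOf η
  -- The shift normalizes the leading term: `(μ/2) g e^{z-c} = e^z`. The quadratic error becomes
  -- `e^{2z-c}`, which is small because `e^c` grows with `μ`.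
  set c := Real.log (μ / 2 * g) with hc
  have hexpc : Real.exp c = μ / 2 * g := Real.exp_log (by positivity)
  refine ⟨c, (admissible_fermi.const_mul (half_pos hμ0)).comp_sub_const c, fun z hz => ?_⟩
  have h1 := abs_fermi_sub_le (z - c)
  rw [← hg] at h1
  have e1 : Real.exp z - fermiDiracF η (z - c) =
      μ / 2 * (g * Real.exp (z - c) - fermi (1 / 2) (z - c)) := by
    have : Real.exp z = μ / 2 * g * Real.exp (z - c) := by
      rw [← hexpc, ← Real.exp_add, add_sub_cancel]
    rw [this, fermiDiracF]
    ring
  rw [e1, abs_mul, abs_of_pos (half_pos hμ0)]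
  calc _ ≤ μ / 2 * (g * Real.exp (2 * (z - c))) := by gcongr
    _ = Real.exp (2 * z) / Real.exp c := by
      rw [← mul_assoc, ← hexpc, ← Real.exp_add, ← Real.exp_sub]
      congr 1
      ring
    _ ≤ Real.exp (2 * A) / Real.exp c := by gcongr
    _ ≤ ε := by
      rw [div_le_iff₀ (Real.exp_pos c), hexpc]
      linarith

/-- Strict alternating signs at finitely many central values survive a small perturbation of the
nonlinearity. The constant `C` is the stability constant of `abs_radialMass_sub_le` times `4π`, so
the masses move by at most half of the smallest margin `δ`. -/
theorem ConvergesToExp.hasAtLeastSolutions {F : ℝ → ℝ → ℝ} (hF : ConvergesToExp F) {N : ℕ} {M : ℝ}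
    {a : ℕ → ℝ} (ha : StrictMono a)
    (hsign : ∀ i ≤ N, 0 < (-1) ^ (i + 1) * (4 * Real.pi * radialMass Real.exp (a i) - M)) :
    ∃ η₀, 0 < η₀ ∧ ∀ η, 0 < η → η < η₀ → HasAtLeastSolutions (F η) M N := by
  obtain ⟨k, hk, hmin⟩ := (Finset.range (N + 1)).exists_min_image
    (fun i => (-1) ^ (i + 1) * (4 * Real.pi * radialMass Real.exp (a i) - M))
    ⟨0, Finset.mem_range.2 (Nat.succ_pos N)⟩
  set δ := (-1) ^ (k + 1) * (4 * Real.pi * radialMass Real.exp (a k) - M) with hδ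
  have hδ0 : 0 < δ := hsign k (Nat.lt_succ_iff.1 (Finset.mem_range.1 hk))
  set A := a N with hA
  set C := 4 * Real.pi * (Real.exp A * (2 * Real.exp (Real.exp A)) + 1) with hC
  have hC0 : 0 < C := by positivity
  obtain ⟨η₀, hη₀, h⟩ := hF A (δ / (2 * C)) (by positivity)
  refine ⟨η₀, hη₀, fun η hη hlt => ?_⟩
  obtain ⟨c, hadm, hclose⟩ := h η hη hlt
  have hpos : ∀ i ≤ N, 0 < (-1) ^ (i + 1) *
      (4 * Real.pi * radialMass (fun z => F η (z - c)) (a i) - M) := by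
    intro i hi
    have hiA : a i ≤ A := ha.monotone hi
    have h1 := abs_radialMass_sub_le admissible_exp hadm hiA hiA (by positivity) hclose
    rw [sub_self, abs_zero, zero_add] at h1
    have h2 : |(-1) ^ (i + 1) * (4 * Real.pi * (radialMass Real.exp (a i)
        - radialMass (fun z => F η (z - c)) (a i)))| ≤ δ / 2 := by
      rw [abs_mul, abs_mul, abs_pow, abs_neg, abs_one, one_pow, one_mul,
        abs_of_pos (show 0 < 4 * Real.pi by positivity)]
      calc _ ≤ 4 * Real.pi * (Real.exp A * (2 * (δ / (2 * C)) * Real.exp (Real.exp A))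
            + δ / (2 * C)) := by gcongr
        _ = C * (δ / (2 * C)) := by rw [hC]; ring
        _ = δ / 2 := by field_simp
    have h3 := hmin i (Finset.mem_range.2 (Nat.lt_succ_of_le hi))
    have h4 := (abs_le.1 h2).2
    have h5 : (-1 : ℝ) ^ (i + 1) * (4 * Real.pi * (radialMass Real.exp (a i)
        - radialMass (fun z => F η (z - c)) (a i))) =
        (-1) ^ (i + 1) * (4 * Real.pi * radialMass Real.exp (a i) - M) -
          (-1) ^ (i + 1) * (4 * Real.pi * radialMass (fun z => F η (z - c)) (a i) - M) := by ring
    rw [h5] at h4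
    linarith
  refine hasAtLeastSolutions_of_sign_changes hadm (fun i _ => ha (Nat.lt_succ_self i)) fun i hi => ?_
  have h1 := mul_pos (hpos i hi.le) (hpos (i + 1) hi)
  rcases neg_one_pow_eq_or ℝ (i + 1) with h2 | h2
  · rw [pow_succ _ (i + 1), h2] at h1
    linarith
  · rw [pow_succ _ (i + 1), h2] at h1
    linarith

theorem theorem1 :
    ∃ Mlo Mup : ℕ+ → ℝ, AreTurningMasses Mlo Mup ∧
      ∀ (n : ℕ+) (M : ℝ), M ∈ Ioo (Mlo n) (Mlo (n + 1)) ∪ Ioo (Mup (n + 1)) (Mup n) →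
        ∃ η₀ : ℝ, 0 < η₀ ∧ ∀ η : ℝ, 0 < η → η < η₀ →
          HasAtLeastSolutions (fermiDiracF η) M (2 * (n : ℕ)) ∧
            HasAtLeastSolutions (simplifiedF η) M (2 * (n : ℕ)) := by
  obtain ⟨x, y, h, hmass⟩ := exists_isHeteroclinic_radialMass
  obtain ⟨z, hz, hT⟩ := h.exists_areTurningMasses
  refine ⟨_, _, hT, fun n M hM => ?_⟩
  set Mlo : ℕ+ → ℝ := fun n => 4 * Real.pi * x (z (2 * n.natPred + 1)) with hMlo
  set Mup : ℕ+ → ℝ := fun n => 4 * Real.pi * x (z (2 * n.natPred)) with hMup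
  -- Both intervals allowed for `M` lie in this larger one, which is all that the count needs.
  have hbetween : Mlo n < M ∧ M < Mup n := by
    rcases hM with hM | hM
    · exact ⟨hM.1, hM.2.trans (hT.lo_lt_up _ _)⟩
    · exact ⟨(hT.lo_lt_up _ _).trans hM.1, hM.2⟩
  have hlo : ∀ k, k < (n : ℕ) → 4 * Real.pi * x (z (2 * k + 1)) < M := by
    intro k hk
    have h1 : Mlo k.succPNat ≤ Mlo n := hT.strictMono_lo.monotone hk
    simp only [hMlo, Nat.natPred_succPNat] at h1
    exact h1.trans_lt hbetween.1
  have hup : ∀ k, k < (n : ℕ) → M < 4 * Real.pi * x (z (2 * k)) := by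
    intro k hk
    have h1 : Mup n ≤ Mup k.succPNat := hT.strictAnti_up.antitone hk
    simp only [hMup, Nat.natPred_succPNat] at h1
    exact hbetween.2.trans_le h1
  have hM0 : 0 < M := lt_trans (mul_pos (by positivity) (h.x_pos _)) (hlo 0 n.pos)
  obtain ⟨s, hs, hsz⟩ : ∃ s, 4 * Real.pi * x s < M ∧ s < z 0 := by
    have h1 := h.tendsto_x_atBot.const_mul (4 * Real.pi)
    rw [mul_zero] at h1
    exact ((h1.eventually (gt_mem_nhds hM0)).and (eventually_lt_atBot (z 0))).exists
  -- The starting point `s` is placed before all critical points: even indices are then below `M`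
  -- (`s` and the minima), odd ones above it (the maxima). Indices `0` to `2n` give `2n` sign
  -- changes.
  let p : ℕ → ℝ := fun i => Nat.casesOn i s z
  have hp : StrictMono p := by
    refine strictMono_nat_of_lt_succ fun i => ?_
    cases i with
    | zero => exact hsz
    | succ k => exact hz (Nat.lt_succ_self k)
  have hsign : ∀ i ≤ 2 * (n : ℕ),
      0 < (-1) ^ (i + 1) * (4 * Real.pi * radialMass Real.exp (2 * p i) - M) := by
    intro i hi
    rw [hmass]
    obtain ⟨k, rfl | rfl⟩ := Nat.even_or_odd' i
    · have h1 : 4 * Real.pi * x (p (2 * k)) < M := by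
        cases k with
        | zero => exact hs
        | succ k => exact hlo k (by omega)
      rw [pow_succ, pow_mul]
      norm_num
      exact h1
    · have h1 : M < 4 * Real.pi * x (p (2 * k + 1)) := hup k (by omega)
      rw [pow_succ, pow_succ, pow_mul]
      norm_num
      exact h1
  have ha : StrictMono fun i => 2 * p i := fun i j hij => mul_lt_mul_of_pos_left (hp hij) two_pos
  obtain ⟨η₁, hη₁, h₁⟩ := convergesToExp_fermiDiracF.hasAtLeastSolutions ha hsign
  obtain ⟨η₂, hη₂, h₂⟩ := convergesToExp_simplifiedF.hasAtLeastSolutions ha hsign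
  exact ⟨min η₁ η₂, lt_min hη₁ hη₂, fun η hη hlt =>
    ⟨h₁ η hη (hlt.trans_le (min_le_left _ _)), h₂ η hη (hlt.trans_le (min_le_right _ _))⟩⟩
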